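/- Let $\alpha,\beta\in\mathbb C$ with $|\alpha|,|\beta|>1$, and fix logarithms $\log\alpha=\log|\alpha|+i\arg\alpha$ and $\log\beta=\log|\beta|+i\arg\beta$. Let $S^1=\mathbb R/2\pi\mathbb Z$, $S^3=\{(\xi_1,\xi_2)\in\mathbb C^2:|\xi_1|^2+|\xi_2|^2=1\}$, and identify $S^1\times S^3$ with the Hopf surface $H_{\alpha,\beta}=(\mathbb C^2\setminus 0)/\langle(z_1,z_2)\mapsto(\alpha z_1,\beta z_2)\rangle$ through the diffeomorphism $(\theta,\xi_1,\xi_2)\mapsto[e^{\theta\log\alpha/2\pi}\xi_1,\,e^{\theta\log\beta/2\pi}\xi_2]$; let $J$ be the resulting complex structure on $S^1\times S^3$. Let $h:\mathbb R\to\mathbb R$ be smooth, positive and $2\pi$-periodic, put $R=|\xi_1|^2\log|\alpha|+|\xi_2|^2\log|\beta|$, and let $g^h$ be the locally conformal Kähler metric on $(S^1\times S^3,J)$ whose Hermitian form (complex linear in the first vector) has, in the $J$-complex basis $e_2=(i\xi_1,i\xi_2)$, $e_3=(-\bar\xi_2,\bar\xi_1)$, the matrix $$\begin{pmatrix}\dfrac{\pi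 h}{R^2}+\dfrac{|\xi_1|^2|\xi_2|^2\log^2(|\alpha|/|\beta|)}{R^3}&\dfrac{i\xi_1\xi_2\log(|\alpha|/|\beta|)}{R^2}\\[2mm]\dfrac{\overline{i\xi_1\xi_2}\log(|\alpha|/|\beta|)}{R^2}&\dfrac1R\end{pmatrix}.$$ Let $\Omega$ be its fundamental form, $\omega$ its Lee form (the $1$-form with $d\Omega=\omega\wedge\Omega$), $B$ the Lee vector field (dual to $\omega$ through $g^h$), and let $\mathcal E_{\alpha,\beta}$ be the $2$-dimensional foliation of $S^1\times S^3$ tangent to $B$ and $JB$. Then, for $(\Theta,\Xi_1,\Xi_2)\in S^1\times S^3$: 1. The leaf of $\mathcal E_{\alpha,\beta}$ through $(\Theta,\Xi_1,0)$ is $S^1\times\{(\xi_1,\xi_2)\in S^3:\xi_2=0\}$, the leaf through $(\Theta,0,\Xi_2)$ is $S^1\times\{(\xi_1,\xi_2)\in S^3:\xi_1=0\}$, and these leaves are compact. 2. If $\Xi_1\Xi_2\ne0$, the leaf $N$ through $(\Theta,\Xi_1,\Xi_2)$ is a subset of $S^1\times T$, where $T=\{(\xi_1,\xi_2):|\xi_1|=|\Xi_1|,\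 |\xi_2|=|\Xi_2|\}$. (a) If there are integers $m,n$, not both zero, with $\alpha^m=\beta^n$, then $N$ is compact. In this case there are integers $k,l,p,q,b,c$ with $k,q\neq0$, $\gcd(k,l)=\gcd(p,q)=1$, $$\frac{k\arg\alpha-l\arg\beta}{\pi}=\frac pq,\qquad\frac{\log|\alpha|}{\log|\beta|}=\frac lk,\qquad bk-cl=1,$$ and for all such integers, setting $(p',q')=(p,q)$ if $p$ is odd and $(p',q')=(p/2,q/2)$ if $p$ is even, the numbers $$v=q'+i\,\frac{q'\arg\beta-p'c\pi}{\log|\beta|},\qquad w=i\,\frac{k\pi}{\log|\beta|}$$ are linearly independent over $\mathbb R$, and $N$ is a complex curve in $(S^1\times S^3,J)$ biholomorphic to the elliptic curve $\mathbb C/\Lambda$, where $\Lambda=\mathbb Zv\oplus\mathbb Zw$. (b) If there are no such integers $m,n$, then $N$ is not compact and is dense in $S^1\times T$. -/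

import Mathlib

open scoped ContDiff ComplexConjugate

noncomputable section

namespace HopfSurface

/-- The ambient space of `ℝ × S³`: points `(θ, ξ₁, ξ₂)`, with `S³ ⊂ ℂ²` the unit sphere. -/
abbrev Cover : Type := ℝ × ℂ × ℂ

/-- The ambient space of `S¹ × S³`, with `S¹ = ℝ / 2πℤ`. -/
abbrev Ambient : Type := Real.Angle × ℂ × ℂ

/-- The universal covering `ℝ × S³` of `S¹ × S³`. -/
def coverRS3 : Set Cover := {p | ‖p.2.1‖ ^ 2 + ‖p.2.2‖ ^ 2 = 1}

/-- The manifold `S¹ × S³`. -/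
def S1xS3 : Set Ambient := {p | ‖p.2.1‖ ^ 2 + ‖p.2.2‖ ^ 2 = 1}

/-- The covering map `(θ, ξ) ↦ (θ mod 2π, ξ)`. All the tensors below are invariant under the deck
transformation `θ ↦ θ + 2π`, so they are tensors on `S¹ × S³`. -/
def proj (p : Cover) : Ambient := ((p.1 : Real.Angle), p.2)

/-- The tangent space of `ℝ × S³` (equivalently of `S¹ × S³`) at `p`, inside `ℝ × ℂ × ℂ`. -/
def tangent (p : Cover) : Submodule ℝ Cover where
  carrier := {v | (conj p.2.1 * v.2.1 + conj p.2.2 * v.2.2).re = 0}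
  add_mem' := by
    intro v w hv hw
    simp only [Set.mem_ofPred_eq, Prod.snd_add, Prod.fst_add] at *
    simp only [Complex.add_re, Complex.mul_re, Complex.add_im] at *
    linarith
  zero_mem' := by simp
  smul_mem' := by
    intro c v hv
    simp only [Set.mem_ofPred_eq, Prod.smul_snd, Prod.smul_fst] at *
    simp only [Complex.add_re, Complex.mul_re, Complex.smul_re, Complex.smul_im,
      smul_eq_mul] at *
    linear_combination c * hv

/-! Throughout, `a` and `b` are logarithms of the complex numbers `α` and `β`. -/

/-- The map `F : ℝ × S³ → ℂ² ∖ 0`, `(θ, ξ₁, ξ₂) ↦ (e^{θ log α / 2π} ξ₁, e^{θ log β / 2π} ξ₂)`. It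
intertwines `θ ↦ θ + 2π` with `(z₁, z₂) ↦ (α z₁, β z₂)`, hence induces the diffeomorphism of
`S¹ × S³` with the Hopf surface `(ℂ² ∖ 0) / ⟨(z₁, z₂) ↦ (α z₁, β z₂)⟩`. -/
def hopfMap (a b : ℂ) (p : Cover) : ℂ × ℂ :=
  (Complex.exp (p.1 * a / (2 * Real.pi)) * p.2.1, Complex.exp (p.1 * b / (2 * Real.pi)) * p.2.2)

/-- The differential of `hopfMap`, up to the diagonal matrix
`diag (e^{θ log α / 2π}, e^{θ log β / 2π})`; see `fderiv_hopfMap`. -/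
def hopfDiff (a b : ℂ) (p v : Cover) : ℂ × ℂ :=
  (a / (2 * Real.pi) * v.1 * p.2.1 + v.2.1, b / (2 * Real.pi) * v.1 * p.2.2 + v.2.2)

theorem fderiv_hopfMap (a b : ℂ) (p v : Cover) :
    fderiv ℝ (hopfMap a b) p v =
      (Complex.exp (p.1 * a / (2 * Real.pi)) * (hopfDiff a b p v).1,
        Complex.exp (p.1 * b / (2 * Real.pi)) * (hopfDiff a b p v).2) := by
  have h0 : HasFDerivAt (fun q : Cover => (q.1 : ℂ))
      (Complex.ofRealCLM.comp (ContinuousLinearMap.fst ℝ ℝ (ℂ × ℂ))) p :=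
    (Complex.ofRealCLM.comp (ContinuousLinearMap.fst ℝ ℝ (ℂ × ℂ))).hasFDerivAt
  have h1 : HasFDerivAt (fun q : Cover => q.2.1)
      ((ContinuousLinearMap.fst ℝ ℂ ℂ).comp (ContinuousLinearMap.snd ℝ ℝ (ℂ × ℂ))) p :=
    ((ContinuousLinearMap.fst ℝ ℂ ℂ).comp (ContinuousLinearMap.snd ℝ ℝ (ℂ × ℂ))).hasFDerivAt
  have h2 : HasFDerivAt (fun q : Cover => q.2.2)
      ((ContinuousLinearMap.snd ℝ ℂ ℂ).comp (ContinuousLinearMap.snd ℝ ℝ (ℂ × ℂ))) p :=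
    ((ContinuousLinearMap.snd ℝ ℂ ℂ).comp (ContinuousLinearMap.snd ℝ ℝ (ℂ × ℂ))).hasFDerivAt
  have key : HasFDerivAt (fun q : Cover =>
      (Complex.exp ((q.1 : ℂ) * (a / (2 * Real.pi))) * q.2.1,
        Complex.exp ((q.1 : ℂ) * (b / (2 * Real.pi))) * q.2.2)) _ p := ((h0.mul_const (a / (2 * Real.pi))).cexp.mul h1).prodMk
    ((h0.mul_const (b / (2 * Real.pi))).cexp.mul h2)
  have e : hopfMap a b = fun q : Cover =>
      (Complex.exp ((q.1 : ℂ) * (a / (2 * Real.pi))) * q.2.1,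
        Complex.exp ((q.1 : ℂ) * (b / (2 * Real.pi))) * q.2.2) := by
    funext q
    simp only [hopfMap, mul_div_assoc]
  rw [e, key.fderiv]
  ext <;> simp [hopfDiff, mul_div_assoc] <;> ring

/-- The function `G = |ξ₁|² log α + |ξ₂|² log β`. -/
def G (a b : ℂ) (p : Cover) : ℂ := ‖p.2.1‖ ^ 2 * a + ‖p.2.2‖ ^ 2 * b

/-- The complex structure `J` on `S¹ × S³` obtained from that of the Hopf surface through the
diffeomorphism induced by `hopfMap`, that is `dF ∘ J = i dF`. The lemmas `J_mem_tangent`,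
`fderiv_hopfMap_J` and `J_unique` show that `J` is this structure. -/
def J (a b : ℂ) (p v : Cover) : Cover :=
  let A := Complex.I • hopfDiff a b p v
  let τ : ℝ := 2 * Real.pi * (conj p.2.1 * A.1 + conj p.2.2 * A.2).re / (G a b p).re
  (τ, A.1 - a / (2 * Real.pi) * τ * p.2.1, A.2 - b / (2 * Real.pi) * τ * p.2.2)

theorem fderiv_hopfMap_J (a b : ℂ) (p v : Cover) :
    fderiv ℝ (hopfMap a b) p (J a b p v) = Complex.I • fderiv ℝ (hopfMap a b) p v := by
  rw [fderiv_hopfMap, fderiv_hopfMap]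
  ext <;> simp [hopfDiff, J] <;> ring

theorem re_G_pos {a b : ℂ} (ha : 0 < a.re) (hb : 0 < b.re) {p : Cover} (hp : p ∈ coverRS3) :
    0 < (G a b p).re := by
  have e : (G a b p).re = ‖p.2.1‖ ^ 2 * a.re + ‖p.2.2‖ ^ 2 * b.re := by
    simp only [G, ← Complex.ofReal_pow, Complex.add_re, Complex.re_ofReal_mul]
  have hp' : ‖p.2.1‖ ^ 2 + ‖p.2.2‖ ^ 2 = 1 := hp
  rw [e]
  rcases (sq_nonneg ‖p.2.1‖).eq_or_lt with h | h
  · rw [← h] at hp' ⊢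
    nlinarith
  · have := mul_pos h ha
    have := mul_nonneg (sq_nonneg ‖p.2.2‖) hb.le
    linarith

theorem re_conj_hopf (a b : ℂ) (p : Cover) (τ : ℝ) :
    (conj p.2.1 * (a / (2 * Real.pi) * τ * p.2.1)
      + conj p.2.2 * (b / (2 * Real.pi) * τ * p.2.2)).re = τ * (G a b p).re / (2 * Real.pi) := by
  have e : conj p.2.1 * (a / (2 * Real.pi) * τ * p.2.1)
      + conj p.2.2 * (b / (2 * Real.pi) * τ * p.2.2)
      = ((τ / (2 * Real.pi) : ℝ) : ℂ) * G a b p := by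
    have h1 := Complex.conj_mul' p.2.1
    have h2 := Complex.conj_mul' p.2.2
    push_cast
    simp only [G]
    rw [← h1, ← h2]
    ring
  rw [e, Complex.re_ofReal_mul]
  ring

theorem J_mem_tangent {a b : ℂ} (ha : 0 < a.re) (hb : 0 < b.re) {p : Cover} (hp : p ∈ coverRS3)
    (v : Cover) : J a b p v ∈ tangent p := by
  have hG := (re_G_pos ha hb hp).ne'
  change (conj p.2.1 * (J a b p v).2.1 + conj p.2.2 * (J a b p v).2.2).re = 0
  simp only [J]
  set A := Complex.I • hopfDiff a b p v
  set τ : ℝ := 2 * Real.pi * (conj p.2.1 * A.1 + conj p.2.2 * A.2).re / (G a b p).re with hτ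
  have e : conj p.2.1 * (A.1 - a / (2 * Real.pi) * τ * p.2.1)
      + conj p.2.2 * (A.2 - b / (2 * Real.pi) * τ * p.2.2)
      = (conj p.2.1 * A.1 + conj p.2.2 * A.2) - (conj p.2.1 * (a / (2 * Real.pi) * τ * p.2.1)
        + conj p.2.2 * (b / (2 * Real.pi) * τ * p.2.2)) := by ring
  rw [e, Complex.sub_re, re_conj_hopf, hτ]
  field_simp
  ring

theorem hopfDiff_injOn {a b : ℂ} (ha : 0 < a.re) (hb : 0 < b.re) {p : Cover} (hp : p ∈ coverRS3)
    {v w : Cover} (hv : v ∈ tangent p) (hw : w ∈ tangent p)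
    (h : hopfDiff a b p v = hopfDiff a b p w) : v = w := by
  have hG := (re_G_pos ha hb hp).ne'
  have hv' : (conj p.2.1 * v.2.1 + conj p.2.2 * v.2.2).re = 0 := hv
  have hw' : (conj p.2.1 * w.2.1 + conj p.2.2 * w.2.2).re = 0 := hw
  have h1 := congrArg Prod.fst h
  have h2 := congrArg Prod.snd h
  simp only [hopfDiff] at h1 h2
  have key := re_conj_hopf a b p (v.1 - w.1)
  have e : conj p.2.1 * (a / (2 * Real.pi) * ((v.1 - w.1 : ℝ) : ℂ) * p.2.1)
      + conj p.2.2 * (b / (2 * Real.pi) * ((v.1 - w.1 : ℝ) : ℂ) * p.2.2)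
      = (conj p.2.1 * w.2.1 + conj p.2.2 * w.2.2) - (conj p.2.1 * v.2.1 + conj p.2.2 * v.2.2) := by
    push_cast
    linear_combination conj p.2.1 * h1 + conj p.2.2 * h2
  rw [e, Complex.sub_re, hv', hw', sub_zero, eq_comm, div_eq_zero_iff] at key
  have h0 : v.1 = w.1 := by
    rcases key with k | k
    · rcases mul_eq_zero.1 k with k | k
      · linarith
      · exact absurd k hG
    · exact absurd k Real.two_pi_pos.ne'
  rw [h0] at h1 h2
  exact Prod.ext h0 (Prod.ext (add_left_cancel h1) (add_left_cancel h2))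

theorem J_unique {a b : ℂ} (ha : 0 < a.re) (hb : 0 < b.re) {p : Cover} (hp : p ∈ coverRS3)
    {v w : Cover} (hw : w ∈ tangent p)
    (h : fderiv ℝ (hopfMap a b) p w = Complex.I • fderiv ℝ (hopfMap a b) p v) :
    w = J a b p v := by
  rw [← fderiv_hopfMap_J, fderiv_hopfMap, fderiv_hopfMap, Prod.mk.injEq] at h
  exact hopfDiff_injOn ha hb hp hw (J_mem_tangent ha hb hp v)
    (Prod.ext (mul_left_cancel₀ (Complex.exp_ne_zero _) h.1)
      (mul_left_cancel₀ (Complex.exp_ne_zero _) h.2))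

/-- The vector field `e₂ = (i ξ₁, i ξ₂)` on `S³`. -/
def e₂ (p : Cover) : Cover := (0, Complex.I * p.2.1, Complex.I * p.2.2)

/-- The vector field `e₃ = (-conj ξ₂, conj ξ₁)` on `S³`. -/
def e₃ (p : Cover) : Cover := (0, -conj p.2.2, conj p.2.1)

/-- The two complex coordinates of a tangent vector in the `J`-complex basis `(e₂, e₃)`; see
`eq_coord`. -/
def coord (a b : ℂ) (p v : Cover) : Fin 2 → ℂ :=
  ![-Complex.I * (conj p.2.1 * (hopfDiff a b p v).1 + conj p.2.2 * (hopfDiff a b p v).2),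
    -p.2.2 * (hopfDiff a b p v).1 + p.2.1 * (hopfDiff a b p v).2]

theorem e₂_mem (p : Cover) : e₂ p ∈ tangent p := by
  change (conj p.2.1 * (e₂ p).2.1 + conj p.2.2 * (e₂ p).2.2).re = 0
  simp [e₂]
  ring

theorem e₃_mem (p : Cover) : e₃ p ∈ tangent p := by
  change (conj p.2.1 * (e₃ p).2.1 + conj p.2.2 * (e₃ p).2.2).re = 0
  simp [e₃]
  ring

/-- `v = x e₂ + y e₃`, where a complex number `x = x' + i x''` acts by `x' + x'' J`. -/
theorem eq_coord {a b : ℂ} (ha : 0 < a.re) (hb : 0 < b.re) {p : Cover} (hp : p ∈ coverRS3)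
    {v : Cover} (hv : v ∈ tangent p) :
    v = (coord a b p v 0).re • e₂ p + (coord a b p v 0).im • J a b p (e₂ p)
      + ((coord a b p v 1).re • e₃ p + (coord a b p v 1).im • J a b p (e₃ p)) := by
  have hadd : ∀ x y, hopfDiff a b p (x + y) = hopfDiff a b p x + hopfDiff a b p y := by
    intro x y
    ext <;> simp [hopfDiff] <;> ring
  have hsmul : ∀ (c : ℝ) x, hopfDiff a b p (c • x) = (c : ℂ) • hopfDiff a b p x := by
    intro c x
    ext <;> simp [hopfDiff] <;> ring
  have hJ : ∀ x, hopfDiff a b p (J a b p x) = Complex.I • hopfDiff a b p x := by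
    intro x
    ext <;> simp [hopfDiff, J]
  have hsq : conj p.2.1 * p.2.1 + conj p.2.2 * p.2.2 = 1 := by
    rw [Complex.conj_mul', Complex.conj_mul']
    have hp' : ‖p.2.1‖ ^ 2 + ‖p.2.2‖ ^ 2 = 1 := hp
    exact_mod_cast hp'
  have hcomb : ∀ (x : ℂ) (u : ℂ × ℂ), (x.re : ℂ) • u + (x.im : ℂ) • Complex.I • u = x • u := by
    intro x u
    rw [smul_smul, ← add_smul, Complex.re_add_im]
  refine hopfDiff_injOn ha hb hp hv (Submodule.add_mem _
    (Submodule.add_mem _ (Submodule.smul_mem _ _ (e₂_mem p))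
      (Submodule.smul_mem _ _ (J_mem_tangent ha hb hp _)))
    (Submodule.add_mem _ (Submodule.smul_mem _ _ (e₃_mem p))
      (Submodule.smul_mem _ _ (J_mem_tangent ha hb hp _)))) ?_
  simp only [hadd, hsmul, hJ, hcomb]
  have h2 : hopfDiff a b p (e₂ p) = (Complex.I * p.2.1, Complex.I * p.2.2) := by
    simp [hopfDiff, e₂]
  have h3 : hopfDiff a b p (e₃ p) = (-conj p.2.2, conj p.2.1) := by
    simp [hopfDiff, e₃]
  rw [h2, h3]
  set u := hopfDiff a b p v with hu
  have hI := Complex.I_mul_I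
  have c0 : coord a b p v 0 = -Complex.I * (conj p.2.1 * u.1 + conj p.2.2 * u.2) := rfl
  have c1 : coord a b p v 1 = -p.2.2 * u.1 + p.2.1 * u.2 := rfl
  rw [c0, c1]
  refine Prod.ext ?_ ?_
  · simp only [Prod.fst_add, Prod.smul_fst, smul_eq_mul]
    linear_combination (-u.1) * hsq + (conj p.2.1 * u.1 + conj p.2.2 * u.2) * p.2.1 * hI
  · simp only [Prod.snd_add, Prod.smul_snd, smul_eq_mul]
    linear_combination (-u.2) * hsq + (conj p.2.1 * u.1 + conj p.2.2 * u.2) * p.2.2 * hI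

/-- The matrix, in the basis `(e₂, e₃)`, of the locally conformal Kähler metric associated with
the positive function `h` on `S¹`. Here `a.re = log |α|` and `b.re = log |β|`. -/
def metricMatrix (a b : ℂ) (h : ℝ → ℝ) (p : Cover) : Matrix (Fin 2) (Fin 2) ℂ :=
  let R : ℝ := (G a b p).re
  let ℓ : ℝ := a.re - b.re
  let x : ℂ := Complex.I * p.2.1 * p.2.2
  !![((Real.pi * h p.1 / R ^ 2 + ‖p.2.1‖ ^ 2 * ‖p.2.2‖ ^ 2 * ℓ ^ 2 / R ^ 3 : ℝ) : ℂ),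
      x * ℓ / R ^ 2;
    conj x * ℓ / R ^ 2, ((1 / R : ℝ) : ℂ)]

/-- The Hermitian form of the metric, complex linear in the first vector. -/
def hermitian (a b : ℂ) (h : ℝ → ℝ) (p v w : Cover) : ℂ :=
  ∑ i, ∑ j, coord a b p v i * conj (coord a b p w j) * metricMatrix a b h p i j

/-- The locally conformal Kähler metric `g^h`. -/
def metric (a b : ℂ) (h : ℝ → ℝ) (p v w : Cover) : ℝ := (hermitian a b h p v w).re

theorem hermitian_self_im (a b : ℂ) (h : ℝ → ℝ) (p v : Cover) :
    (hermitian a b h p v v).im = 0 := by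
  rw [← Complex.conj_eq_iff_im]
  have e : ∀ i j, conj (metricMatrix a b h p i j) = metricMatrix a b h p j i := by
    intro i j
    fin_cases i <;> fin_cases j <;>
      simp only [metricMatrix, Fin.zero_eta, Fin.mk_one, Matrix.of_apply, Matrix.cons_val_zero,
        Matrix.cons_val_one, Complex.conj_ofReal, map_div₀, map_mul, map_pow, Complex.conj_conj]
  simp only [hermitian, Fin.sum_univ_two, map_add, map_mul, Complex.conj_conj, e]
  ring

theorem coord_add (a b : ℂ) (p v w : Cover) (i : Fin 2) :
    coord a b p (v + w) i = coord a b p v i + coord a b p w i := by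
  fin_cases i <;> simp [coord, hopfDiff] <;> ring

theorem coord_smul (a b : ℂ) (p v : Cover) (c : ℝ) (i : Fin 2) :
    coord a b p (c • v) i = c * coord a b p v i := by
  fin_cases i <;> simp [coord, hopfDiff] <;> ring

theorem continuous_coord (a b : ℂ) (p : Cover) (i : Fin 2) : Continuous (coord a b p · i) := by
  fin_cases i <;>
  · simp only [coord, hopfDiff, Fin.zero_eta, Fin.mk_one, Matrix.cons_val_zero,
      Matrix.cons_val_one]
    fun_prop

theorem hermitian_add_left (a b : ℂ) (h : ℝ → ℝ) (p v v' w : Cover) :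
    hermitian a b h p (v + v') w = hermitian a b h p v w + hermitian a b h p v' w := by
  simp only [hermitian, coord_add, add_mul, Finset.sum_add_distrib]

theorem hermitian_add_right (a b : ℂ) (h : ℝ → ℝ) (p v w w' : Cover) :
    hermitian a b h p v (w + w') = hermitian a b h p v w + hermitian a b h p v w' := by
  simp only [hermitian, coord_add, map_add, mul_add, add_mul, Finset.sum_add_distrib]

theorem hermitian_smul_left (a b : ℂ) (h : ℝ → ℝ) (p v w : Cover) (c : ℝ) :
    hermitian a b h p (c • v) w = c * hermitian a b h p v w := by
  simp only [hermitian, coord_smul, Finset.mul_sum, mul_assoc]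

theorem hermitian_smul_right (a b : ℂ) (h : ℝ → ℝ) (p v w : Cover) (c : ℝ) :
    hermitian a b h p v (c • w) = c * hermitian a b h p v w := by
  simp only [hermitian, coord_smul, map_mul, Complex.conj_ofReal, Finset.mul_sum]
  refine Finset.sum_congr rfl fun i _ => Finset.sum_congr rfl fun j _ => ?_
  ring

theorem continuous_hermitian (a b : ℂ) (h : ℝ → ℝ) (p : Cover) :
    Continuous fun v : Fin 2 → Cover => hermitian a b h p (v 0) (v 1) :=
  continuous_finsetSum _ fun i _ => continuous_finsetSum _ fun j _ =>
    (((continuous_coord a b p i).comp (continuous_apply 0)).mul (Complex.continuous_conj.comp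
      ((continuous_coord a b p j).comp (continuous_apply 1)))).mul continuous_const

theorem im_hermitian_update_add (a b : ℂ) (h : ℝ → ℝ) (p : Cover) (m : Fin 2 → Cover) (i : Fin 2)
    (x y : Cover) :
    -(hermitian a b h p (Function.update m i (x + y) 0) (Function.update m i (x + y) 1)).im =
      -(hermitian a b h p (Function.update m i x 0) (Function.update m i x 1)).im +
      -(hermitian a b h p (Function.update m i y 0) (Function.update m i y 1)).im := by
  fin_cases i <;>
  · simp [hermitian_add_left, hermitian_add_right, -neg_add_rev]
    ring

theorem im_hermitian_update_smul (a b : ℂ) (h : ℝ → ℝ) (p : Cover) (m : Fin 2 → Cover)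
    (i : Fin 2) (c : ℝ) (x : Cover) :
    -(hermitian a b h p (Function.update m i (c • x) 0) (Function.update m i (c • x) 1)).im =
      c • -(hermitian a b h p (Function.update m i x 0) (Function.update m i x 1)).im := by
  fin_cases i <;>
  simp [hermitian_smul_left, hermitian_smul_right]

/-- The fundamental form `Ω` of `g^h`, with `hermitian = g^h - i Ω`. The formula makes sense in a
neighbourhood of `ℝ × S³` in `ℝ × ℂ × ℂ`; only its restriction to `ℝ × S³` matters. -/
def fundamentalForm (a b : ℂ) (h : ℝ → ℝ) (p : Cover) : Cover [⋀^Fin 2]→L[ℝ] ℝ where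
  toFun v := -(hermitian a b h p (v 0) (v 1)).im
  map_update_add' := by
    intro inst m i x y
    rw [Subsingleton.elim inst (instDecidableEqFin 2)]
    exact im_hermitian_update_add a b h p m i x y
  map_update_smul' := by
    intro inst m i c x
    rw [Subsingleton.elim inst (instDecidableEqFin 2)]
    exact im_hermitian_update_smul a b h p m i c x
  cont := (Complex.continuous_im.comp (continuous_hermitian a b h p)).neg
  map_eq_zero_of_eq' := by
    intro v i j hv hij
    have h01 : v 0 = v 1 := by
      fin_cases i <;> fin_cases j <;> simp_all
    change -(hermitian a b h p (v 0) (v 1)).im = 0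
    rw [h01, hermitian_self_im, neg_zero]

/-- `B` is the Lee vector of `g^h` at `p`: the vector dual through `g^h` to the Lee form `η`, the
`1`-form with `dΩ = η ∧ Ω`. As `Ω` is nondegenerate on a space of dimension `4`, this
equation determines `η` at `p`. The exterior derivative on `ℝ × S³` is the restriction to tangent
vectors of the exterior derivative of the extension of `Ω` to a neighbourhood. -/
def IsLeeVector (a b : ℂ) (h : ℝ → ℝ) (p B : Cover) : Prop :=
  B ∈ tangent p ∧ ∃ η : Cover →L[ℝ] ℝ,
    (∀ X ∈ tangent p, metric a b h p B X = η X) ∧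
    ∀ X ∈ tangent p, ∀ Y ∈ tangent p, ∀ Z ∈ tangent p,
      extDeriv (fundamentalForm a b h) p ![X, Y, Z] =
        η X * fundamentalForm a b h p ![Y, Z] + η Y * fundamentalForm a b h p ![Z, X]
          + η Z * fundamentalForm a b h p ![X, Y]

/-- The canonical distribution spanned by the Lee vector field `B` and by `J B`. -/
def distribution (a b : ℂ) (h : ℝ → ℝ) (p : Cover) : Submodule ℝ Cover :=
  Submodule.span ℝ {v | ∃ B, IsLeeVector a b h p B ∧ (v = B ∨ v = J a b p B)}

/-- The leaf through `P` of the foliation of `S¹ × S³` tangent to the distribution: the set of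
endpoints of the `C¹` curves in `S¹ × S³` that start at `P` and are everywhere tangent to it. Curves
in `S¹ × S³` are written through their lifts to `ℝ × S³`. -/
def leaf (a b : ℂ) (h : ℝ → ℝ) (P : Ambient) : Set Ambient :=
  {Q | ∃ γ : ℝ → Cover, ContDiff ℝ 1 γ ∧ (∀ t, γ t ∈ coverRS3) ∧
    (∀ t, deriv γ t ∈ distribution a b h (γ t)) ∧ proj (γ 0) = P ∧ proj (γ 1) = Q}

/-- The subset `S¹ × T` of `S¹ × S³`, where `T` is the product of the circles of radius `|Ξ₁|` and
`|Ξ₂|`. -/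
def S1xT (Ξ₁ Ξ₂ : ℂ) : Set Ambient := {P | ‖P.2.1‖ = ‖Ξ₁‖ ∧ ‖P.2.2‖ = ‖Ξ₂‖}

/-- The subset `N` of `S¹ × S³` is a compact complex curve biholomorphic to `ℂ / Λ`: there is a
homeomorphism of `ℂ / Λ` onto `N` which, as a map from `ℂ / Λ` to `S¹ × S³`, is a smooth immersion
and is holomorphic for `J`. Smoothness and holomorphy are read on a lift `Ψ : ℂ → ℝ × S³` to the
universal coverings. -/
def IsBiholomorphicToTorus (a b : ℂ) (Λ : AddSubgroup ℂ) (N : Set Ambient) : Prop :=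
  ∃ (φ : (ℂ ⧸ Λ) ≃ₜ N) (Ψ : ℂ → Cover),
    ContDiff ℝ ∞ Ψ ∧ (∀ z, Ψ z ∈ coverRS3) ∧
    (∀ z, proj (Ψ z) = (φ (QuotientAddGroup.mk z) : Ambient)) ∧
    (∀ z, Function.Injective (fderiv ℝ Ψ z)) ∧
    ∀ z ζ, fderiv ℝ Ψ z (Complex.I * ζ) = J a b (Ψ z) (fderiv ℝ Ψ z ζ)

/-- The conditions on the integers that define the lattice, where `a.im = arg α`,
`a.re = log |α|` and likewise for `β`. -/
structure LatticeData (a b : ℂ) (k l p q r s : ℤ) : Prop where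
  k_ne_zero : k ≠ 0
  q_ne_zero : q ≠ 0
  coprime_kl : IsCoprime k l
  coprime_pq : IsCoprime p q
  arg_eq : (k * a.im - l * b.im) / Real.pi = (p : ℝ) / q
  log_eq : a.re / b.re = (l : ℝ) / k
  bezout : r * k - s * l = 1

/-- `x` if `p` is odd and `x / 2` (not rounded) if `p` is even. -/
def halfIfEven (p x : ℤ) : ℝ := if Odd p then (x : ℝ) else (x : ℝ) / 2

/-- The first generator of the lattice. -/
def latticeV (b : ℂ) (p q s : ℤ) : ℂ :=
  ⟨halfIfEven p q, (halfIfEven p q * b.im - halfIfEven p p * s * Real.pi) / b.re⟩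

/-- The second generator of the lattice. -/
def latticeW (b : ℂ) (k : ℤ) : ℂ := ⟨0, k * Real.pi / b.re⟩

end HopfSurface

end

noncomputable section

set_option linter.unusedSimpArgs false

/-! Write `R` for the real part of `G`. Completing the square in the Hermitian matrix
(`hermitian_eq`) splits the form into a term in `radialPart` with weight `π h / R²` and a term in
`transversePart` with weight `1 / R`. The frame `leafX`, `leafY = J leafX`, `e₃`, `Je₃ = J e₃` is
adapted to this splitting: the first two vectors kill `transversePart`, the last two kill
`radialPart`.

On this frame `Ω` has only the entries `π h` and `1 / R`, and the only nonzero value of `dΩ` is `-2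
π h / R`, on `(leafX, e₃, Je₃)`. Hence the Lee form is `-h dθ`. On tangent vectors `leafX` is dual
to `(h / 2) dθ`, so the Lee vector is `-2 leafX` whatever `h` is (`isLeeVector_leafX`,
`eq_of_isLeeVector`), and the distribution is spanned by `leafX` and `leafY`
(`mem_distribution_iff`).

These two fields commute and integrate explicitly: parameters `(x, y)` shift `θ` by `2 π x` and
rotate the coordinates `ξ₁`, `ξ₂` by the angles `-arg α x + log|α| y` and `-arg β x + log|β| y`.
Leaves are the orbits of this action of `ℝ²` (`leaf_eq`), which settles the case where a coordinate
vanishes.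

When both coordinates are nonzero, everything depends on which `(x, y)` bring a point back. The
rotations of `ξ₂` that occur when `θ` and `ξ₁` return form a countable subgroup of `ℝ`. Without a
relation `α^m = β^n` it is dense, so the leaf is dense in `S¹ × T` but is not all of it
(`closure_leaf`, `not_isCompact_leaf`). With a relation, the period group is twice the lattice of
the statement (`period_iff_mem_lattice`), and the orbit map descends to a holomorphic bijection from
a complex torus onto the leaf (`isBiholomorphicToTorus_leaf`). -/

namespace HopfSurface

/-! ### Splitting of the metric and the frame adapted to the foliation -/

/-- The component of `v` along the complex line through `p`, measured in `ℂ²`. -/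
def radialPart (a b : ℂ) (p v : Cover) : ℂ :=
  conj p.2.1 * (hopfDiff a b p v).1 + conj p.2.2 * (hopfDiff a b p v).2

/-- The component of `v` transverse to the foliation. -/
def transversePart (a b : ℂ) (p v : Cover) : ℂ :=
  coord a b p v 1
    + p.2.1 * p.2.2 * ((a.re - b.re : ℝ) : ℂ) / ((G a b p).re : ℂ) * radialPart a b p v

/-- Completing the square with respect to the `e₃` coordinate: the off-diagonal entry is absorbed in
the correction term of `transversePart`, and the `ℓ² / R³` part of the first entry is exactly what
the square uses up. Only `R ≠ 0` is needed, not `p ∈ coverRS3`, so the formula may be differentiated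
in directions of the ambient space. -/
theorem hermitian_eq {a b : ℂ} (h : ℝ → ℝ) {p : Cover} (hG : (G a b p).re ≠ 0) (v w : Cover) :
    hermitian a b h p v w =
      Real.pi * h p.1 / ((G a b p).re : ℂ) ^ 2 * radialPart a b p v * conj (radialPart a b p w)
      + transversePart a b p v * conj (transversePart a b p w) / ((G a b p).re : ℂ) := by
  have hG' : ((G a b p).re : ℂ) ≠ 0 := by exact_mod_cast hG
  have h0 : ∀ v, coord a b p v 0 = -Complex.I * radialPart a b p v := fun v => rfl
  have hx := Complex.conj_mul' p.2.1
  have hy := Complex.conj_mul' p.2.2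
  simp only [hermitian, Fin.sum_univ_two, h0, transversePart, metricMatrix]
  -- The identity is polynomial once these values are treated as independent variables.
  generalize coord a b p v 1 = cv
  generalize coord a b p w 1 = cw
  generalize radialPart a b p v = dv
  generalize radialPart a b p w = dw
  simp only [Matrix.of_apply, Matrix.cons_val_zero, Matrix.cons_val_one, map_mul, map_add,
    map_neg, map_div₀, Complex.conj_I, Complex.conj_ofReal]
  push_cast
  rw [← hx, ← hy]
  generalize ((G a b p).re : ℂ) = R at hG' ⊢
  field_simp
  simp only [Complex.I_sq]
  ring

/-- The vector field whose image in `ℂ²` is `(log |α| z₁, log |β| z₂)`. -/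
def leafX (a b : ℂ) (p : Cover) : Cover :=
  (2 * Real.pi, -(a.im * Complex.I) * p.2.1, -(b.im * Complex.I) * p.2.2)

/-- The vector field whose image in `ℂ²` is `(i log |α| z₁, i log |β| z₂)`. -/
def leafY (a b : ℂ) (p : Cover) : Cover :=
  (0, a.re * Complex.I * p.2.1, b.re * Complex.I * p.2.2)

theorem hopfDiff_leafX (a b : ℂ) (p : Cover) :
    hopfDiff a b p (leafX a b p) = (a.re * p.2.1, b.re * p.2.2) := by
  have hπ : (Real.pi : ℂ) ≠ 0 := by exact_mod_cast Real.pi_ne_zero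
  have ha := Complex.re_add_im a
  have hb := Complex.re_add_im b
  ext
  · simp only [hopfDiff, leafX]
    push_cast
    field_simp
    linear_combination (-p.2.1) * ha
  · simp only [hopfDiff, leafX]
    push_cast
    field_simp
    linear_combination (-p.2.2) * hb

theorem hopfDiff_leafY (a b : ℂ) (p : Cover) :
    hopfDiff a b p (leafY a b p) = Complex.I • (a.re * p.2.1, b.re * p.2.2) := by
  ext <;> simp [hopfDiff, leafY] <;> ring

theorem leafX_mem (a b : ℂ) (p : Cover) : leafX a b p ∈ tangent p := by
  change (conj p.2.1 * (leafX a b p).2.1 + conj p.2.2 * (leafX a b p).2.2).re = 0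
  simp [leafX]
  ring

theorem leafY_mem (a b : ℂ) (p : Cover) : leafY a b p ∈ tangent p := by
  change (conj p.2.1 * (leafY a b p).2.1 + conj p.2.2 * (leafY a b p).2.2).re = 0
  simp [leafY]
  ring

theorem hopfDiff_J (a b : ℂ) (p v : Cover) :
    hopfDiff a b p (J a b p v) = Complex.I • hopfDiff a b p v := by
  ext <;> simp [hopfDiff, J]

theorem hopfDiff_add (a b : ℂ) (p x y : Cover) :
    hopfDiff a b p (x + y) = hopfDiff a b p x + hopfDiff a b p y := by
  ext <;> simp [hopfDiff] <;> ring

theorem hopfDiff_smul (a b : ℂ) (p : Cover) (c : ℝ) (x : Cover) :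
    hopfDiff a b p (c • x) = (c : ℂ) • hopfDiff a b p x := by
  ext <;> simp [hopfDiff] <;> ring

/-- In the parameters of the flow `J` is multiplication by `i`; this is what makes the
parametrisation of a leaf holomorphic. -/
theorem J_comb_leaf {a b : ℂ} (ha : 0 < a.re) (hb : 0 < b.re) {p : Cover} (hp : p ∈ coverRS3)
    (u v : ℝ) : J a b p (u • leafX a b p + v • leafY a b p)
      = -v • leafX a b p + u • leafY a b p := by
  refine hopfDiff_injOn ha hb hp (J_mem_tangent ha hb hp _)
    (Submodule.add_mem _ (Submodule.smul_mem _ _ (leafX_mem a b p))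
      (Submodule.smul_mem _ _ (leafY_mem a b p))) ?_
  have hI := Complex.I_mul_I
  simp only [hopfDiff_J, hopfDiff_add, hopfDiff_smul, hopfDiff_leafX, hopfDiff_leafY]
  ext
  · simp
    linear_combination v * a.re * p.2.1 * hI
  · simp
    linear_combination v * b.re * p.2.2 * hI

/-- The field `i e₃ = J e₃`. -/
def Je₃ (p : Cover) : Cover := (0, -(Complex.I * conj p.2.2), Complex.I * conj p.2.1)

theorem Je₃_mem (p : Cover) : Je₃ p ∈ tangent p := by
  change (conj p.2.1 * (Je₃ p).2.1 + conj p.2.2 * (Je₃ p).2.2).re = 0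
  simp [Je₃]
  ring

theorem radialPart_leafX (a b : ℂ) (p : Cover) :
    radialPart a b p (leafX a b p) = (G a b p).re := by
  have hx := Complex.conj_mul' p.2.1
  have hy := Complex.conj_mul' p.2.2
  have e : (G a b p).re = ‖p.2.1‖ ^ 2 * a.re + ‖p.2.2‖ ^ 2 * b.re := by
    simp only [G, ← Complex.ofReal_pow, Complex.add_re, Complex.re_ofReal_mul]
  rw [radialPart, hopfDiff_leafX, e]
  push_cast
  rw [← hx, ← hy]
  ring

theorem radialPart_leafY (a b : ℂ) (p : Cover) :
    radialPart a b p (leafY a b p) = Complex.I * (G a b p).re := by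
  rw [← radialPart_leafX, radialPart, radialPart, hopfDiff_leafX, hopfDiff_leafY]
  simp
  ring

theorem transversePart_leafX {a b : ℂ} {p : Cover} (hG : (G a b p).re ≠ 0) :
    transversePart a b p (leafX a b p) = 0 := by
  have hG' : ((G a b p).re : ℂ) ≠ 0 := by exact_mod_cast hG
  rw [transversePart, radialPart_leafX, div_mul_cancel₀ _ hG']
  simp [coord, hopfDiff_leafX]
  ring

theorem transversePart_leafY {a b : ℂ} {p : Cover} (hG : (G a b p).re ≠ 0) :
    transversePart a b p (leafY a b p) = 0 := by
  have hG' : ((G a b p).re : ℂ) ≠ 0 := by exact_mod_cast hG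
  rw [transversePart, radialPart_leafY]
  simp [coord, hopfDiff_leafY]
  field_simp
  ring

theorem radialPart_e₃ (a b : ℂ) (p : Cover) : radialPart a b p (e₃ p) = 0 := by
  simp [radialPart, hopfDiff, e₃]
  ring

theorem radialPart_Je₃ (a b : ℂ) (p : Cover) : radialPart a b p (Je₃ p) = 0 := by
  simp [radialPart, hopfDiff, Je₃]
  ring

theorem conj_mul_add_conj_mul {p : Cover} (hp : p ∈ coverRS3) :
    conj p.2.1 * p.2.1 + conj p.2.2 * p.2.2 = 1 := by
  rw [Complex.conj_mul', Complex.conj_mul']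
  have hp' : ‖p.2.1‖ ^ 2 + ‖p.2.2‖ ^ 2 = 1 := hp
  exact_mod_cast hp'

theorem transversePart_e₃ (a b : ℂ) {p : Cover} (hp : p ∈ coverRS3) :
    transversePart a b p (e₃ p) = 1 := by
  rw [transversePart, radialPart_e₃]
  simp [coord, hopfDiff, e₃]
  linear_combination conj_mul_add_conj_mul hp

theorem transversePart_Je₃ (a b : ℂ) {p : Cover} (hp : p ∈ coverRS3) :
    transversePart a b p (Je₃ p) = Complex.I := by
  rw [transversePart, radialPart_Je₃]
  simp [coord, hopfDiff, Je₃]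
  linear_combination Complex.I * conj_mul_add_conj_mul hp

/-- `radialPart` and `transversePart` are obtained from the two complex coordinates by an invertible
triangular change. -/
theorem eq_of_parts {a b : ℂ} (ha : 0 < a.re) (hb : 0 < b.re) {p : Cover} (hp : p ∈ coverRS3)
    {v w : Cover} (hv : v ∈ tangent p) (hw : w ∈ tangent p)
    (h1 : radialPart a b p v = radialPart a b p w)
    (h2 : transversePart a b p v = transversePart a b p w) : v = w := by
  have c0 : coord a b p v 0 = coord a b p w 0 := by
    change -Complex.I * radialPart a b p v = -Complex.I * radialPart a b p w
    rw [h1]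
  have c1 : coord a b p v 1 = coord a b p w 1 := by
    rw [transversePart, transversePart, h1] at h2
    exact add_right_cancel h2
  rw [eq_coord ha hb hp hv, eq_coord ha hb hp hw, c0, c1]

theorem radialPart_add (a b : ℂ) (p v w : Cover) :
    radialPart a b p (v + w) = radialPart a b p v + radialPart a b p w := by
  simp only [radialPart, hopfDiff_add, Prod.fst_add, Prod.snd_add]
  ring

theorem radialPart_smul (a b : ℂ) (p : Cover) (c : ℝ) (v : Cover) :
    radialPart a b p (c • v) = c * radialPart a b p v := by
  simp only [radialPart, hopfDiff_smul, Prod.smul_fst, Prod.smul_snd, smul_eq_mul]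
  ring

theorem transversePart_add (a b : ℂ) (p v w : Cover) :
    transversePart a b p (v + w) = transversePart a b p v + transversePart a b p w := by
  simp only [transversePart, radialPart_add, coord_add]
  ring

theorem transversePart_smul (a b : ℂ) (p : Cover) (c : ℝ) (v : Cover) :
    transversePart a b p (c • v) = c * transversePart a b p v := by
  simp only [transversePart, radialPart_smul, coord_smul]
  ring

/-- The tangent frame adapted to the foliation. -/
theorem eq_frame_comb {a b : ℂ} (ha : 0 < a.re) (hb : 0 < b.re) {p : Cover} (hp : p ∈ coverRS3)
    {v : Cover} (hv : v ∈ tangent p) :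
    v = ((radialPart a b p v).re / (G a b p).re) • leafX a b p
      + ((radialPart a b p v).im / (G a b p).re) • leafY a b p
      + (transversePart a b p v).re • e₃ p + (transversePart a b p v).im • Je₃ p := by
  have hG := (re_G_pos ha hb hp).ne'
  have hG' : ((G a b p).re : ℂ) ≠ 0 := by exact_mod_cast hG
  refine eq_of_parts ha hb hp hv (Submodule.add_mem _ (Submodule.add_mem _ (Submodule.add_mem _
    (Submodule.smul_mem _ _ (leafX_mem a b p)) (Submodule.smul_mem _ _ (leafY_mem a b p)))
    (Submodule.smul_mem _ _ (e₃_mem p))) (Submodule.smul_mem _ _ (Je₃_mem p))) ?_ ?_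
  · simp only [radialPart_add, radialPart_smul, radialPart_leafX, radialPart_leafY, radialPart_e₃,
      radialPart_Je₃]
    push_cast
    field_simp
    linear_combination -Complex.re_add_im (radialPart a b p v)
  · simp only [transversePart_add, transversePart_smul, transversePart_leafX hG,
      transversePart_leafY hG, transversePart_e₃ a b hp, transversePart_Je₃ a b hp]
    linear_combination -Complex.re_add_im (transversePart a b p v)

/-- Tangency to the sphere removes the contribution of the `ξ` components; what remains is `R dθ /
2π`, which is the source of the `dθ` in the Lee form. -/
theorem radialPart_re {a b : ℂ} {p v : Cover} (hv : v ∈ tangent p) :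
    (radialPart a b p v).re = v.1 * (G a b p).re / (2 * Real.pi) := by
  have hv' : (conj p.2.1 * v.2.1 + conj p.2.2 * v.2.2).re = 0 := hv
  have key := re_conj_hopf a b p v.1
  have e : radialPart a b p v = conj p.2.1 * (a / (2 * Real.pi) * v.1 * p.2.1)
      + conj p.2.2 * (b / (2 * Real.pi) * v.1 * p.2.2)
      + (conj p.2.1 * v.2.1 + conj p.2.2 * v.2.2) := by
    simp only [radialPart, hopfDiff]
    ring
  rw [e, Complex.add_re, key, hv', add_zero]

/-! ### Differentiability of the fundamental form -/

/-- A differential form is differentiable if all its values on constant vectors are. -/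
theorem differentiableAt_of_apply {E : Type*} [NormedAddCommGroup E] [NormedSpace ℝ E]
    [FiniteDimensional ℝ E] {n : ℕ} {form : E → E [⋀^Fin n]→L[ℝ] ℝ} {p : E}
    (hf : ∀ v : Fin n → E, DifferentiableAt ℝ (fun q => form q v) p) : DifferentiableAt ℝ form p := by
  let ι := Fin n → Fin (Module.finrank ℝ E)
  let e := Module.finBasis ℝ E
  let L : (E [⋀^Fin n]→L[ℝ] ℝ) →ₗ[ℝ] (ι → ℝ) :=
    { toFun := fun η i => η fun j => e (i j)
      map_add' := fun _ _ => rfl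
      map_smul' := fun _ _ => rfl }
  -- A form is determined by its values on tuples of basis vectors, so it is recovered from them by
  -- a linear map, continuous in finite dimension.
  have hL : LinearMap.ker L = ⊥ := by
    rw [LinearMap.ker_eq_bot]
    intro η η' hη
    apply ContinuousAlternatingMap.toAlternatingMap_injective
    refine Module.Basis.ext_alternating e fun i _ => ?_
    exact congrFun hη i
  obtain ⟨K, hK⟩ := L.exists_leftInverse_of_injective hL
  have e1 : form = fun q => LinearMap.toContinuousLinearMap K (L (form q)) := by
    funext q
    exact (LinearMap.congr_fun hK (form q)).symm
  rw [e1]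
  refine (LinearMap.toContinuousLinearMap K).differentiableAt.comp p ?_
  rw [differentiableAt_pi]
  exact fun i => hf _

theorem re_G (a b : ℂ) (p : Cover) :
    (G a b p).re = (p.2.1.re ^ 2 + p.2.1.im ^ 2) * a.re + (p.2.2.re ^ 2 + p.2.2.im ^ 2) * b.re := by
  simp only [G, ← Complex.ofReal_pow, Complex.add_re, Complex.re_ofReal_mul, Complex.sq_norm,
    Complex.normSq_apply]
  ring

theorem differentiable_re_G (a b : ℂ) : Differentiable ℝ fun p => (G a b p).re := by
  simp only [re_G]
  have h1 : Differentiable ℝ fun p : Cover => p.2.1.re :=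
    Complex.reCLM.differentiable.comp (by fun_prop)
  have h2 : Differentiable ℝ fun p : Cover => p.2.1.im :=
    Complex.imCLM.differentiable.comp (by fun_prop)
  have h3 : Differentiable ℝ fun p : Cover => p.2.2.re :=
    Complex.reCLM.differentiable.comp (by fun_prop)
  have h4 : Differentiable ℝ fun p : Cover => p.2.2.im :=
    Complex.imCLM.differentiable.comp (by fun_prop)
  fun_prop

theorem differentiable_ofReal {E : Type*} [NormedAddCommGroup E] [NormedSpace ℝ E] {f : E → ℝ}
    {p : E} (hf : DifferentiableAt ℝ f p) : DifferentiableAt ℝ (fun q => (f q : ℂ)) p :=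
  Complex.ofRealCLM.differentiableAt.comp p hf

theorem differentiable_conj {E : Type*} [NormedAddCommGroup E] [NormedSpace ℝ E] {f : E → ℂ}
    {p : E} (hf : DifferentiableAt ℝ f p) : DifferentiableAt ℝ (fun q => conj (f q)) p :=
  Complex.conjCLE.differentiableAt.comp p hf

theorem differentiableAt_radialPart (a b : ℂ) (p v : Cover) :
    DifferentiableAt ℝ (fun q => radialPart a b q v) p := by
  have h1 : DifferentiableAt ℝ (fun q : Cover => conj q.2.1) p := differentiable_conj (by fun_prop)
  have h2 : DifferentiableAt ℝ (fun q : Cover => conj q.2.2) p := differentiable_conj (by fun_prop)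
  simp only [radialPart, hopfDiff]
  fun_prop

theorem differentiableAt_transversePart {a b : ℂ} {p : Cover} (hG : (G a b p).re ≠ 0)
    (v : Cover) : DifferentiableAt ℝ (fun q => transversePart a b q v) p := by
  have h1 := differentiableAt_radialPart a b p v
  have h2 := differentiable_ofReal (differentiable_re_G a b p)
  have hG' : ((G a b p).re : ℂ) ≠ 0 := by exact_mod_cast hG
  have h3 := h2.inv hG'
  simp only [transversePart, coord, Matrix.cons_val_one, Matrix.cons_val_zero, hopfDiff,
    div_eq_mul_inv]
  fun_prop

theorem eventually_re_G_ne_zero {a b : ℂ} {p : Cover} (hG : (G a b p).re ≠ 0) :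
    ∀ᶠ q in nhds p, (G a b q).re ≠ 0 :=
  (differentiable_re_G a b).continuous.continuousAt.eventually_ne hG

theorem differentiableAt_hermitian {a b : ℂ} {h : ℝ → ℝ} (hh : Differentiable ℝ h) {p : Cover}
    (hG : (G a b p).re ≠ 0) (v w : Cover) :
    DifferentiableAt ℝ (fun q => hermitian a b h q v w) p := by
  have h2 := differentiable_ofReal (differentiable_re_G a b p)
  have hG' : ((G a b p).re : ℂ) ≠ 0 := by exact_mod_cast hG
  have h3 := h2.inv hG'
  have h4 : DifferentiableAt ℝ (fun q : Cover => (h q.1 : ℂ)) p :=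
    differentiable_ofReal ((hh p.1).comp p (by fun_prop))
  have r1 := differentiableAt_radialPart a b p v
  have r2 := differentiable_conj (differentiableAt_radialPart a b p w)
  have t1 := differentiableAt_transversePart hG v
  have t2 := differentiable_conj (differentiableAt_transversePart hG w)
  refine DifferentiableAt.congr_of_eventuallyEq (f := fun q =>
      Real.pi * h q.1 * ((((G a b q).re : ℂ))⁻¹) ^ 2 * radialPart a b q v
        * conj (radialPart a b q w)
      + transversePart a b q v * conj (transversePart a b q w) * (((G a b q).re : ℂ))⁻¹) ?_ ?_
  · fun_prop
  · filter_upwards [eventually_re_G_ne_zero hG] with q hq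
    rw [hermitian_eq h hq, inv_pow]
    rfl

theorem differentiableAt_fundamentalForm {a b : ℂ} {h : ℝ → ℝ} (hh : Differentiable ℝ h)
    {p : Cover} (hG : (G a b p).re ≠ 0) : DifferentiableAt ℝ (fundamentalForm a b h) p :=
  differentiableAt_of_apply fun v =>
    (Complex.imCLM.differentiableAt.comp p (differentiableAt_hermitian hh hG (v 0) (v 1))).neg

/-! ### Directional derivatives of the Hermitian form and the exterior derivative -/

/-- With the tangent argument held constant, the real part of `G`, `radialPart` and the second
coordinate are polynomials of degree at most two along each line `p + t X`; their derivatives are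
read off as linear coefficients. -/
theorem hasDerivAt_of_quadratic {f : ℝ → ℂ} (c₀ c₁ c₂ : ℂ)
    (hf : ∀ t : ℝ, f t = c₀ + t * c₁ + t ^ 2 * c₂) : HasDerivAt f c₁ 0 := by
  have e : f = fun t : ℝ => c₀ + t * c₁ + t ^ 2 * c₂ := funext hf
  have h0 : HasDerivAt (fun t : ℝ => (t : ℂ)) 1 0 := Complex.ofRealCLM.hasDerivAt
  have := ((h0.mul_const c₁).const_add c₀).add ((h0.pow 2).mul_const c₂)
  rw [e]
  exact this.congr_deriv (by simp)

/-- The derivative of `G` along `X`. -/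
def dG (a b : ℂ) (p X : Cover) : ℂ :=
  (conj X.2.1 * p.2.1 + conj p.2.1 * X.2.1) * a + (conj X.2.2 * p.2.2 + conj p.2.2 * X.2.2) * b

/-- The derivative of the real part of `G` along `X`. -/
def dReG (a b : ℂ) (p X : Cover) : ℂ :=
  (conj X.2.1 * p.2.1 + conj p.2.1 * X.2.1) * a.re
    + (conj X.2.2 * p.2.2 + conj p.2.2 * X.2.2) * b.re

/-- The derivative of `radialPart` along `X`. -/
def dRadial (a b : ℂ) (p X v : Cover) : ℂ :=
  v.1 / (2 * Real.pi) * dG a b p X + (conj X.2.1 * v.2.1 + conj X.2.2 * v.2.2)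

/-- The derivative of `coord · · · 1` along `X`. -/
def dCoord (a b : ℂ) (p X v : Cover) : ℂ :=
  v.1 / (2 * Real.pi) * (b - a) * (X.2.1 * p.2.2 + p.2.1 * X.2.2)
    + (X.2.1 * v.2.2 - X.2.2 * v.2.1)

/-- The derivative of `transversePart` along `X`. -/
def dTransverse (a b : ℂ) (p X v : Cover) : ℂ :=
  dCoord a b p X v + ((a.re - b.re : ℝ) : ℂ) *
    (((X.2.1 * p.2.2 + p.2.1 * X.2.2) * radialPart a b p v
        + p.2.1 * p.2.2 * dRadial a b p X v) / ((G a b p).re : ℂ)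
      - p.2.1 * p.2.2 * radialPart a b p v * dReG a b p X / ((G a b p).re : ℂ) ^ 2)

/-- The derivative of `hermitian` along `X`. -/
def dHermitian (a b : ℂ) (h : ℝ → ℝ) (p X v w : Cover) : ℂ :=
  Real.pi * (X.1 * deriv h p.1 / ((G a b p).re : ℂ) ^ 2
      - 2 * h p.1 * dReG a b p X / ((G a b p).re : ℂ) ^ 3)
    * radialPart a b p v * conj (radialPart a b p w)
  + Real.pi * h p.1 / ((G a b p).re : ℂ) ^ 2 *
    (dRadial a b p X v * conj (radialPart a b p w)
      + radialPart a b p v * conj (dRadial a b p X w))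
  + (dTransverse a b p X v * conj (transversePart a b p w)
      + transversePart a b p v * conj (dTransverse a b p X w)) / ((G a b p).re : ℂ)
  - transversePart a b p v * conj (transversePart a b p w) * dReG a b p X
      / ((G a b p).re : ℂ) ^ 2

theorem ofReal_re_G (a b : ℂ) (p : Cover) :
    ((G a b p).re : ℂ) = conj p.2.1 * p.2.1 * a.re + conj p.2.2 * p.2.2 * b.re := by
  rw [Complex.conj_mul', Complex.conj_mul']
  simp only [G, ← Complex.ofReal_pow, Complex.add_re, Complex.re_ofReal_mul]
  push_cast
  ring

theorem hasDerivAt_re_G (a b : ℂ) (p X : Cover) :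
    HasDerivAt (fun t : ℝ => ((G a b (p + t • X)).re : ℂ)) (dReG a b p X) 0 := by
  refine hasDerivAt_of_quadratic ((G a b p).re : ℂ) _ ((G a b X).re : ℂ) fun t => ?_
  simp only [ofReal_re_G, dReG, Prod.fst_add, Prod.snd_add, Prod.smul_fst, Prod.smul_snd, map_add,
    Complex.real_smul, map_mul, Complex.conj_ofReal]
  ring

theorem hasDerivAt_radialPart (a b : ℂ) (p X v : Cover) :
    HasDerivAt (fun t : ℝ => radialPart a b (p + t • X) v) (dRadial a b p X v) 0 := by
  refine hasDerivAt_of_quadratic (radialPart a b p v) _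
    (v.1 / (2 * Real.pi) * (conj X.2.1 * X.2.1 * a + conj X.2.2 * X.2.2 * b)) fun t => ?_
  simp only [radialPart, hopfDiff, dRadial, dG, Prod.fst_add, Prod.snd_add, Prod.smul_fst,
    Prod.smul_snd, map_add, Complex.real_smul, map_mul, Complex.conj_ofReal]
  ring

theorem hasDerivAt_coord (a b : ℂ) (p X v : Cover) :
    HasDerivAt (fun t : ℝ => coord a b (p + t • X) v 1) (dCoord a b p X v) 0 := by
  refine hasDerivAt_of_quadratic (coord a b p v 1) _
    (v.1 / (2 * Real.pi) * (b - a) * (X.2.1 * X.2.2)) fun t => ?_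
  simp only [coord, Matrix.cons_val_one, Matrix.cons_val_zero, hopfDiff, dCoord, Prod.fst_add,
    Prod.snd_add, Prod.smul_fst, Prod.smul_snd, Complex.real_smul]
  ring

theorem hasDerivAt_transversePart {a b : ℂ} {p : Cover} (hG : (G a b p).re ≠ 0) (X v : Cover) :
    HasDerivAt (fun t : ℝ => transversePart a b (p + t • X) v) (dTransverse a b p X v) 0 := by
  have hG' : ((G a b (p + (0 : ℝ) • X)).re : ℂ) ≠ 0 := by simpa using hG
  have hG'' : ((G a b p).re : ℂ) ≠ 0 := by exact_mod_cast hG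
  have h1 : HasDerivAt (fun t : ℝ => (p + t • X).2.1 * (p + t • X).2.2)
      (X.2.1 * p.2.2 + p.2.1 * X.2.2) 0 := by
    refine hasDerivAt_of_quadratic (p.2.1 * p.2.2) _ (X.2.1 * X.2.2) fun t => ?_
    simp only [Prod.fst_add, Prod.snd_add, Prod.smul_fst, Prod.smul_snd, Complex.real_smul]
    ring
  have := (hasDerivAt_coord a b p X v).add ((((h1.mul_const ((a.re - b.re : ℝ) : ℂ)).div
    (hasDerivAt_re_G a b p X) hG').mul (hasDerivAt_radialPart a b p X v)))
  refine this.congr_deriv ?_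
  simp only [Pi.div_apply, zero_smul, add_zero, dTransverse]
  field_simp
  ring

theorem hasDerivAt_conj {f : ℝ → ℂ} {f' : ℂ} {t : ℝ} (hf : HasDerivAt f f' t) :
    HasDerivAt (fun t => conj (f t)) (conj f') t :=
  Complex.conjCLE.hasFDerivAt.comp_hasDerivAt t hf

theorem hasDerivAt_hermitian {a b : ℂ} {h : ℝ → ℝ} (hh : Differentiable ℝ h) {p : Cover}
    (hG : (G a b p).re ≠ 0) (X v w : Cover) :
    HasDerivAt (fun t : ℝ => hermitian a b h (p + t • X) v w) (dHermitian a b h p X v w) 0 := by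
  have hG'' : ((G a b p).re : ℂ) ≠ 0 := by exact_mod_cast hG
  have hG' : ((G a b (p + (0 : ℝ) • X)).re : ℂ) ≠ 0 := by simpa using hG
  have hG2 : ((G a b (p + (0 : ℝ) • X)).re : ℂ) ^ 2 ≠ 0 := pow_ne_zero _ hG'
  have hl : HasDerivAt (fun t : ℝ => (p + t • X).1) X.1 0 := by
    have := ((hasDerivAt_id (0 : ℝ)).mul_const X.1).const_add p.1
    simpa using this
  have hl' : HasDerivAt h (deriv h p.1) ((p + (0 : ℝ) • X).1) := by
    simpa using (hh p.1).hasDerivAt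
  have h1 : HasDerivAt (fun t : ℝ => (h (p + t • X).1 : ℂ)) ((deriv h p.1 * X.1 : ℝ) : ℂ) 0 :=
    (hl'.comp (0 : ℝ) hl).ofReal_comp
  have hR := hasDerivAt_re_G a b p X
  have key := ((((h1.const_mul (Real.pi : ℂ)).div (hR.pow 2) hG2).mul
      (hasDerivAt_radialPart a b p X v)).mul (hasDerivAt_conj (hasDerivAt_radialPart a b p X w))).add
    (((hasDerivAt_transversePart hG X v).mul
      (hasDerivAt_conj (hasDerivAt_transversePart hG X w))).div hR hG')
  -- The split expression of the form is only available where `R ≠ 0`, which is an open condition.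
  have hev : ∀ᶠ t : ℝ in nhds 0, (G a b (p + t • X)).re ≠ 0 := by
    have hc : Filter.Tendsto (fun t : ℝ => p + t • X) (nhds 0) (nhds p) := by
      have : Continuous fun t : ℝ => p + t • X := by fun_prop
      simpa using this.tendsto 0
    exact hc.eventually (eventually_re_G_ne_zero hG)
  refine (key.congr_of_eventuallyEq ?_).congr_deriv ?_
  · filter_upwards [hev] with t ht
    exact hermitian_eq h ht v w
  · simp only [zero_smul, add_zero, dHermitian, Pi.pow_apply, Pi.mul_apply, Pi.div_apply]
    push_cast
    field_simp
    ring

/-- The arguments are extended as constant vector fields of the ambient vector space, whose brackets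
vanish; only the three directional derivatives remain. -/
theorem extDeriv_fundamentalForm {a b : ℂ} {h : ℝ → ℝ} (hh : Differentiable ℝ h) {p : Cover}
    (hG : (G a b p).re ≠ 0) (X Y Z : Cover) :
    extDeriv (fundamentalForm a b h) p ![X, Y, Z] =
      -(dHermitian a b h p X Y Z - dHermitian a b h p Y X Z + dHermitian a b h p Z X Y).im := by
  have hd : ∀ X v w : Cover, fderiv ℝ (fun q => fundamentalForm a b h q ![v, w]) p X
      = -(dHermitian a b h p X v w).im := by
    intro X v w
    have h1 : DifferentiableAt ℝ (fun q => fundamentalForm a b h q ![v, w]) p :=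
      (Complex.imCLM.differentiableAt.comp p (differentiableAt_hermitian hh hG v w)).neg
    rw [← h1.lineDeriv_eq_fderiv]
    have h2 : HasDerivAt (fun t : ℝ => -(hermitian a b h (p + t • X) v w).im)
        (-(dHermitian a b h p X v w).im) 0 :=
      (Complex.imCLM.hasFDerivAt.comp_hasDerivAt (0 : ℝ) (hasDerivAt_hermitian hh hG X v w)).neg
    exact h2.deriv
  rw [extDeriv_apply (differentiableAt_fundamentalForm hh hG), Fin.sum_univ_three]
  have r0 : (0 : Fin 3).removeNth ![X, Y, Z] = ![Y, Z] := by
    ext i : 1; fin_cases i <;> rfl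
  have r1 : (1 : Fin 3).removeNth ![X, Y, Z] = ![X, Z] := by
    ext i : 1; fin_cases i <;> rfl
  have r2 : (2 : Fin 3).removeNth ![X, Y, Z] = ![X, Y] := by
    ext i : 1; fin_cases i <;> rfl
  rw [r0, r1, r2, hd, hd, hd]
  simp
  ring

/-! ### Derivatives of the two parts along the adapted frame -/

/-- In this table the second vector is frozen at its value at `p`: the entries are not derivatives
of `radialPart` along the frame fields, and so they need not vanish although those functions are
simple. -/
theorem dRadial_leafX_leafY (a b : ℂ) (p : Cover) :
    dRadial a b p (leafX a b p) (leafY a b p) = -(a.re * a.im * (conj p.2.1 * p.2.1) + b.re *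
      b.im * (conj p.2.2 * p.2.2)) := by
  have hI := Complex.I_sq
  simp only [dRadial, dG, leafX, leafY, e₃, Je₃, map_mul, map_neg, Complex.conj_I,
    Complex.conj_ofReal, Complex.conj_conj, map_zero, Complex.ofReal_mul, Complex.ofReal_ofNat,
    Complex.ofReal_zero, zero_div, zero_mul, zero_add]
  linear_combination ((a.re * a.im * (conj p.2.1 * p.2.1) + b.re * b.im * (conj p.2.2 *
    p.2.2))) * hI

theorem dRadial_leafY_leafX (a b : ℂ) (p : Cover) :
    dRadial a b p (leafY a b p) (leafX a b p) = -(a.re * a.im * (conj p.2.1 * p.2.1) + b.re *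
      b.im * (conj p.2.2 * p.2.2)) := by
  have hI := Complex.I_sq
  have hπ : (Real.pi : ℂ) ≠ 0 := by exact_mod_cast Real.pi_ne_zero
  have h1 : 2 * (Real.pi : ℂ) / (2 * Real.pi) = 1 := by field_simp
  simp only [dRadial, dG, leafX, leafY, e₃, Je₃, map_mul, map_neg, Complex.conj_I,
    Complex.conj_ofReal, Complex.conj_conj, map_zero, Complex.ofReal_mul, Complex.ofReal_ofNat,
    Complex.ofReal_zero, zero_div, zero_mul, zero_add]
  rw [h1]
  linear_combination ((a.re * a.im * (conj p.2.1 * p.2.1) + b.re * b.im * (conj p.2.2 *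
    p.2.2))) * hI

theorem dRadial_leafX_e₃ (a b : ℂ) (p : Cover) :
    dRadial a b p (leafX a b p) (e₃ p) = -Complex.I * (a.im - b.im) * (conj p.2.1 * conj p.2.2)
      := by
  simp only [dRadial, dG, leafX, leafY, e₃, Je₃, map_mul, map_neg, Complex.conj_I,
    Complex.conj_ofReal, Complex.conj_conj, map_zero, Complex.ofReal_mul, Complex.ofReal_ofNat,
    Complex.ofReal_zero, zero_div, zero_mul, zero_add]
  ring

theorem dRadial_leafX_Je₃ (a b : ℂ) (p : Cover) :
    dRadial a b p (leafX a b p) (Je₃ p) = (a.im - b.im) * (conj p.2.1 * conj p.2.2) := by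
  have hI := Complex.I_sq
  simp only [dRadial, dG, leafX, leafY, e₃, Je₃, map_mul, map_neg, Complex.conj_I,
    Complex.conj_ofReal, Complex.conj_conj, map_zero, Complex.ofReal_mul, Complex.ofReal_ofNat,
    Complex.ofReal_zero, zero_div, zero_mul, zero_add]
  linear_combination -(a.im - b.im) * (conj p.2.1 * conj p.2.2) * hI

theorem dRadial_leafY_e₃ (a b : ℂ) (p : Cover) :
    dRadial a b p (leafY a b p) (e₃ p) = Complex.I * (a.re - b.re) * (conj p.2.1 * conj p.2.2)
      := by
  simp only [dRadial, dG, leafX, leafY, e₃, Je₃, map_mul, map_neg, Complex.conj_I,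
    Complex.conj_ofReal, Complex.conj_conj, map_zero, Complex.ofReal_mul, Complex.ofReal_ofNat,
    Complex.ofReal_zero, zero_div, zero_mul, zero_add]
  ring

theorem dRadial_leafY_Je₃ (a b : ℂ) (p : Cover) :
    dRadial a b p (leafY a b p) (Je₃ p) = -(a.re - b.re) * (conj p.2.1 * conj p.2.2) := by
  have hI := Complex.I_sq
  simp only [dRadial, dG, leafX, leafY, e₃, Je₃, map_mul, map_neg, Complex.conj_I,
    Complex.conj_ofReal, Complex.conj_conj, map_zero, Complex.ofReal_mul, Complex.ofReal_ofNat,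
    Complex.ofReal_zero, zero_div, zero_mul, zero_add]
  linear_combination (a.re - b.re) * (conj p.2.1 * conj p.2.2) * hI

theorem dRadial_e₃_leafX (a b : ℂ) (p : Cover) :
    dRadial a b p (e₃ p) (leafX a b p) = -(a.re - b.re) * ((p.2.1 * p.2.2) + (conj p.2.1 * conj
      p.2.2)) - Complex.I * (a.im - b.im) * (conj p.2.1 * conj p.2.2) := by
  have hπ : (Real.pi : ℂ) ≠ 0 := by exact_mod_cast Real.pi_ne_zero
  have h1 : 2 * (Real.pi : ℂ) / (2 * Real.pi) = 1 := by field_simp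
  have ha := Complex.re_add_im a
  have hb := Complex.re_add_im b
  simp only [dRadial, dG, leafX, leafY, e₃, Je₃, map_mul, map_neg, Complex.conj_I,
    Complex.conj_ofReal, Complex.conj_conj, map_zero, Complex.ofReal_mul, Complex.ofReal_ofNat,
    Complex.ofReal_zero, zero_div, zero_mul, zero_add]
  rw [h1]
  linear_combination ((p.2.1 * p.2.2) + (conj p.2.1 * conj p.2.2)) * (ha - hb)

theorem dRadial_e₃_leafY (a b : ℂ) (p : Cover) :
    dRadial a b p (e₃ p) (leafY a b p) = -Complex.I * (a.re - b.re) * (p.2.1 * p.2.2) := by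
  simp only [dRadial, dG, leafX, leafY, e₃, Je₃, map_mul, map_neg, Complex.conj_I,
    Complex.conj_ofReal, Complex.conj_conj, map_zero, Complex.ofReal_mul, Complex.ofReal_ofNat,
    Complex.ofReal_zero, zero_div, zero_mul, zero_add]
  ring

theorem dRadial_Je₃_leafX (a b : ℂ) (p : Cover) :
    dRadial a b p (Je₃ p) (leafX a b p) = Complex.I * (a.re - b.re) * ((p.2.1 * p.2.2) - (conj
      p.2.1 * conj p.2.2)) + (a.im - b.im) * (conj p.2.1 * conj p.2.2) := by
  have hI := Complex.I_sq
  have hπ : (Real.pi : ℂ) ≠ 0 := by exact_mod_cast Real.pi_ne_zero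
  have h1 : 2 * (Real.pi : ℂ) / (2 * Real.pi) = 1 := by field_simp
  have ha := Complex.re_add_im a
  have hb := Complex.re_add_im b
  simp only [dRadial, dG, leafX, leafY, e₃, Je₃, map_mul, map_neg, Complex.conj_I,
    Complex.conj_ofReal, Complex.conj_conj, map_zero, Complex.ofReal_mul, Complex.ofReal_ofNat,
    Complex.ofReal_zero, zero_div, zero_mul, zero_add]
  rw [h1]
  linear_combination Complex.I * ((p.2.1 * p.2.2) - (conj p.2.1 * conj p.2.2)) * (hb - ha) -
    (a.im - b.im) * (conj p.2.1 * conj p.2.2) * hI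

theorem dRadial_Je₃_leafY (a b : ℂ) (p : Cover) :
    dRadial a b p (Je₃ p) (leafY a b p) = -(a.re - b.re) * (p.2.1 * p.2.2) := by
  have hI := Complex.I_sq
  simp only [dRadial, dG, leafX, leafY, e₃, Je₃, map_mul, map_neg, Complex.conj_I,
    Complex.conj_ofReal, Complex.conj_conj, map_zero, Complex.ofReal_mul, Complex.ofReal_ofNat,
    Complex.ofReal_zero, zero_div, zero_mul, zero_add]
  linear_combination (a.re - b.re) * (p.2.1 * p.2.2) * hI

/-- This entry and its opposite for the exchanged pair express the twisting of the Hopf fibration;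
they alone produce the nonzero value of `dΩ`. -/
theorem dRadial_e₃_Je₃ (a b : ℂ) {p : Cover} (hp : p ∈ coverRS3) :
    dRadial a b p (e₃ p) (Je₃ p) = Complex.I := by
  simp only [dRadial, dG, leafX, leafY, e₃, Je₃, map_mul, map_neg, Complex.conj_I,
    Complex.conj_ofReal, Complex.conj_conj, map_zero, Complex.ofReal_mul, Complex.ofReal_ofNat,
    Complex.ofReal_zero, zero_div, zero_mul, zero_add]
  linear_combination Complex.I * conj_mul_add_conj_mul hp

theorem dRadial_Je₃_e₃ (a b : ℂ) {p : Cover} (hp : p ∈ coverRS3) :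
    dRadial a b p (Je₃ p) (e₃ p) = -Complex.I := by
  simp only [dRadial, dG, leafX, leafY, e₃, Je₃, map_mul, map_neg, Complex.conj_I,
    Complex.conj_ofReal, Complex.conj_conj, map_zero, Complex.ofReal_mul, Complex.ofReal_ofNat,
    Complex.ofReal_zero, zero_div, zero_mul, zero_add]
  linear_combination -Complex.I * conj_mul_add_conj_mul hp

theorem dTransverse_leafX_leafY {a b : ℂ} {p : Cover} (hG : (G a b p).re ≠ 0) :
    dTransverse a b p (leafX a b p) (leafY a b p) = (a.re * a.im - b.re * b.im - (a.re - b.re) *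
      (a.re * a.im * (conj p.2.1 * p.2.1) + b.re * b.im * (conj p.2.2 * p.2.2)) / ((G a b p).re :
      ℂ)) * (p.2.1 * p.2.2) := by
  have hG' : ((G a b p).re : ℂ) ≠ 0 := by exact_mod_cast hG
  rw [dTransverse, dRadial_leafX_leafY, radialPart_leafY]
  simp only [dCoord, dReG, leafX, leafY, e₃, Je₃, map_mul, map_neg,
    Complex.conj_I, Complex.conj_ofReal, Complex.conj_conj, Complex.ofReal_mul,
    Complex.ofReal_ofNat, Complex.ofReal_sub, Complex.ofReal_zero, zero_div, zero_mul, zero_add,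
    mul_zero, sub_zero]
  have hG2 := pow_ne_zero 2 hG'
  have hI := Complex.I_sq
  have hR := ofReal_re_G a b p
  generalize ((G a b p).re : ℂ) = R at *
  grind

theorem dTransverse_leafY_leafX {a b : ℂ} {p : Cover} (hG : (G a b p).re ≠ 0) :
    dTransverse a b p (leafY a b p) (leafX a b p) = (a.re * a.im - b.re * b.im - (a.re - b.re) *
      (a.re * a.im * (conj p.2.1 * p.2.1) + b.re * b.im * (conj p.2.2 * p.2.2)) / ((G a b p).re :
      ℂ)) * (p.2.1 * p.2.2) := by
  have hG' : ((G a b p).re : ℂ) ≠ 0 := by exact_mod_cast hG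
  have hπ : (Real.pi : ℂ) ≠ 0 := by exact_mod_cast Real.pi_ne_zero
  have h1 : 2 * (Real.pi : ℂ) / (2 * Real.pi) = 1 := by field_simp
  have ha := Complex.re_add_im a
  have hb := Complex.re_add_im b
  rw [dTransverse, dRadial_leafY_leafX, radialPart_leafX]
  simp only [dCoord, dReG, leafX, leafY, e₃, Je₃, map_mul, map_neg,
    Complex.conj_I, Complex.conj_ofReal, Complex.conj_conj, Complex.ofReal_mul,
    Complex.ofReal_ofNat, Complex.ofReal_sub, Complex.ofReal_zero, zero_div, zero_mul, zero_add,
    mul_zero, sub_zero]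
  rw [h1]
  have hG2 := pow_ne_zero 2 hG'
  have hI := Complex.I_sq
  have hR := ofReal_re_G a b p
  generalize ((G a b p).re : ℂ) = R at *
  grind

theorem dTransverse_leafX_e₃ {a b : ℂ} {p : Cover} (hG : (G a b p).re ≠ 0) :
    dTransverse a b p (leafX a b p) (e₃ p) = -Complex.I * (a.im * (conj p.2.1 * p.2.1) + b.im *
      (conj p.2.2 * p.2.2) + (a.re - b.re) * (a.im - b.im) * ((conj p.2.1 * p.2.1) * (conj p.2.2 *
      p.2.2)) / ((G a b p).re : ℂ)) := by
  have hG' : ((G a b p).re : ℂ) ≠ 0 := by exact_mod_cast hG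
  rw [dTransverse, dRadial_leafX_e₃, radialPart_e₃]
  simp only [dCoord, dReG, leafX, leafY, e₃, Je₃, map_mul, map_neg,
    Complex.conj_I, Complex.conj_ofReal, Complex.conj_conj, Complex.ofReal_mul,
    Complex.ofReal_ofNat, Complex.ofReal_sub, Complex.ofReal_zero, zero_div, zero_mul, zero_add,
    mul_zero, sub_zero]
  have hG2 := pow_ne_zero 2 hG'
  have hI := Complex.I_sq
  have hR := ofReal_re_G a b p
  generalize ((G a b p).re : ℂ) = R at *
  grind

theorem dTransverse_leafX_Je₃ {a b : ℂ} {p : Cover} (hG : (G a b p).re ≠ 0) :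
    dTransverse a b p (leafX a b p) (Je₃ p) = (a.im * (conj p.2.1 * p.2.1) + b.im * (conj p.2.2
      * p.2.2) + (a.re - b.re) * (a.im - b.im) * ((conj p.2.1 * p.2.1) * (conj p.2.2 * p.2.2)) /
      ((G a b p).re : ℂ)) := by
  have hG' : ((G a b p).re : ℂ) ≠ 0 := by exact_mod_cast hG
  rw [dTransverse, dRadial_leafX_Je₃, radialPart_Je₃]
  simp only [dCoord, dReG, leafX, leafY, e₃, Je₃, map_mul, map_neg,
    Complex.conj_I, Complex.conj_ofReal, Complex.conj_conj, Complex.ofReal_mul,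
    Complex.ofReal_ofNat, Complex.ofReal_sub, Complex.ofReal_zero, zero_div, zero_mul, zero_add,
    mul_zero, sub_zero]
  have hG2 := pow_ne_zero 2 hG'
  have hI := Complex.I_sq
  have hR := ofReal_re_G a b p
  generalize ((G a b p).re : ℂ) = R at *
  grind

theorem dTransverse_leafY_e₃ {a b : ℂ} {p : Cover} (hG : (G a b p).re ≠ 0) :
    dTransverse a b p (leafY a b p) (e₃ p) = Complex.I * (((G a b p).re : ℂ) + (a.re - b.re) ^ 2
      * ((conj p.2.1 * p.2.1) * (conj p.2.2 * p.2.2)) / ((G a b p).re : ℂ)) := by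
  have hG' : ((G a b p).re : ℂ) ≠ 0 := by exact_mod_cast hG
  rw [dTransverse, dRadial_leafY_e₃, radialPart_e₃]
  simp only [dCoord, dReG, leafX, leafY, e₃, Je₃, map_mul, map_neg,
    Complex.conj_I, Complex.conj_ofReal, Complex.conj_conj, Complex.ofReal_mul,
    Complex.ofReal_ofNat, Complex.ofReal_sub, Complex.ofReal_zero, zero_div, zero_mul, zero_add,
    mul_zero, sub_zero]
  have hG2 := pow_ne_zero 2 hG'
  have hI := Complex.I_sq
  have hR := ofReal_re_G a b p
  generalize ((G a b p).re : ℂ) = R at *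
  grind

theorem dTransverse_leafY_Je₃ {a b : ℂ} {p : Cover} (hG : (G a b p).re ≠ 0) :
    dTransverse a b p (leafY a b p) (Je₃ p) = -(((G a b p).re : ℂ) + (a.re - b.re) ^ 2 * ((conj
      p.2.1 * p.2.1) * (conj p.2.2 * p.2.2)) / ((G a b p).re : ℂ)) := by
  have hG' : ((G a b p).re : ℂ) ≠ 0 := by exact_mod_cast hG
  rw [dTransverse, dRadial_leafY_Je₃, radialPart_Je₃]
  simp only [dCoord, dReG, leafX, leafY, e₃, Je₃, map_mul, map_neg,
    Complex.conj_I, Complex.conj_ofReal, Complex.conj_conj, Complex.ofReal_mul,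
    Complex.ofReal_ofNat, Complex.ofReal_sub, Complex.ofReal_zero, zero_div, zero_mul, zero_add,
    mul_zero, sub_zero]
  have hG2 := pow_ne_zero 2 hG'
  have hI := Complex.I_sq
  have hR := ofReal_re_G a b p
  generalize ((G a b p).re : ℂ) = R at *
  grind

theorem dTransverse_e₃_leafX {a b : ℂ} {p : Cover} (hG : (G a b p).re ≠ 0) :
    dTransverse a b p (e₃ p) (leafX a b p) = Complex.I * (a.im * (conj p.2.2 * p.2.2) + b.im *
      (conj p.2.1 * p.2.1) - (a.re - b.re) * (a.im - b.im) * ((conj p.2.1 * p.2.1) * (conj p.2.2 *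
      p.2.2)) / ((G a b p).re : ℂ)) := by
  have hG' : ((G a b p).re : ℂ) ≠ 0 := by exact_mod_cast hG
  have hπ : (Real.pi : ℂ) ≠ 0 := by exact_mod_cast Real.pi_ne_zero
  have h1 : 2 * (Real.pi : ℂ) / (2 * Real.pi) = 1 := by field_simp
  have ha := Complex.re_add_im a
  have hb := Complex.re_add_im b
  rw [dTransverse, dRadial_e₃_leafX, radialPart_leafX]
  simp only [dCoord, dReG, leafX, leafY, e₃, Je₃, map_mul, map_neg,
    Complex.conj_I, Complex.conj_ofReal, Complex.conj_conj, Complex.ofReal_mul,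
    Complex.ofReal_ofNat, Complex.ofReal_sub, Complex.ofReal_zero, zero_div, zero_mul, zero_add,
    mul_zero, sub_zero]
  rw [h1]
  have hG2 := pow_ne_zero 2 hG'
  have hI := Complex.I_sq
  have hR := ofReal_re_G a b p
  generalize ((G a b p).re : ℂ) = R at *
  grind

theorem dTransverse_e₃_leafY {a b : ℂ} {p : Cover} (hG : (G a b p).re ≠ 0) :
    dTransverse a b p (e₃ p) (leafY a b p) = Complex.I * ((a.re - b.re) * ((conj p.2.1 * p.2.1)
      - (conj p.2.2 * p.2.2)) + (a.re - b.re) ^ 2 * ((conj p.2.1 * p.2.1) * (conj p.2.2 * p.2.2))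
      / ((G a b p).re : ℂ) - ((G a b p).re : ℂ)) := by
  have hG' : ((G a b p).re : ℂ) ≠ 0 := by exact_mod_cast hG
  rw [dTransverse, dRadial_e₃_leafY, radialPart_leafY]
  simp only [dCoord, dReG, leafX, leafY, e₃, Je₃, map_mul, map_neg,
    Complex.conj_I, Complex.conj_ofReal, Complex.conj_conj, Complex.ofReal_mul,
    Complex.ofReal_ofNat, Complex.ofReal_sub, Complex.ofReal_zero, zero_div, zero_mul, zero_add,
    mul_zero, sub_zero]
  have hG2 := pow_ne_zero 2 hG'
  have hI := Complex.I_sq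
  have hR := ofReal_re_G a b p
  generalize ((G a b p).re : ℂ) = R at *
  grind

theorem dTransverse_Je₃_leafX {a b : ℂ} {p : Cover} (hG : (G a b p).re ≠ 0) :
    dTransverse a b p (Je₃ p) (leafX a b p) = -(a.im * (conj p.2.2 * p.2.2) + b.im * (conj p.2.1
      * p.2.1) - (a.re - b.re) * (a.im - b.im) * ((conj p.2.1 * p.2.1) * (conj p.2.2 * p.2.2)) /
      ((G a b p).re : ℂ)) := by
  have hG' : ((G a b p).re : ℂ) ≠ 0 := by exact_mod_cast hG
  have hπ : (Real.pi : ℂ) ≠ 0 := by exact_mod_cast Real.pi_ne_zero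
  have h1 : 2 * (Real.pi : ℂ) / (2 * Real.pi) = 1 := by field_simp
  have ha := Complex.re_add_im a
  have hb := Complex.re_add_im b
  rw [dTransverse, dRadial_Je₃_leafX, radialPart_leafX]
  simp only [dCoord, dReG, leafX, leafY, e₃, Je₃, map_mul, map_neg,
    Complex.conj_I, Complex.conj_ofReal, Complex.conj_conj, Complex.ofReal_mul,
    Complex.ofReal_ofNat, Complex.ofReal_sub, Complex.ofReal_zero, zero_div, zero_mul, zero_add,
    mul_zero, sub_zero]
  rw [h1]
  have hG2 := pow_ne_zero 2 hG'
  have hI := Complex.I_sq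
  have hR := ofReal_re_G a b p
  generalize ((G a b p).re : ℂ) = R at *
  grind

theorem dTransverse_Je₃_leafY {a b : ℂ} {p : Cover} (hG : (G a b p).re ≠ 0) :
    dTransverse a b p (Je₃ p) (leafY a b p) = -((a.re - b.re) * ((conj p.2.1 * p.2.1) - (conj
      p.2.2 * p.2.2)) + (a.re - b.re) ^ 2 * ((conj p.2.1 * p.2.1) * (conj p.2.2 * p.2.2)) / ((G a
      b p).re : ℂ) - ((G a b p).re : ℂ)) := by
  have hG' : ((G a b p).re : ℂ) ≠ 0 := by exact_mod_cast hG
  rw [dTransverse, dRadial_Je₃_leafY, radialPart_leafY]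
  simp only [dCoord, dReG, leafX, leafY, e₃, Je₃, map_mul, map_neg,
    Complex.conj_I, Complex.conj_ofReal, Complex.conj_conj, Complex.ofReal_mul,
    Complex.ofReal_ofNat, Complex.ofReal_sub, Complex.ofReal_zero, zero_div, zero_mul, zero_add,
    mul_zero, sub_zero]
  have hG2 := pow_ne_zero 2 hG'
  have hI := Complex.I_sq
  have hR := ofReal_re_G a b p
  generalize ((G a b p).re : ℂ) = R at *
  grind

/-! ### The exterior derivative of the fundamental form on the frame -/

theorem im_eq_of_sub_conj {z : ℂ} {c : ℝ} (hz : z - conj z = 2 * c * Complex.I) : z.im = c := by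
  have := congrArg Complex.im hz
  simp at this
  linarith

/-- The flow of this field preserves `|ξ₁|` and `|ξ₂|`, hence `R`. -/
theorem dReG_leafX (a b : ℂ) (p : Cover) : dReG a b p (leafX a b p) = 0 := by
  simp only [dReG, leafX, map_mul, map_neg, Complex.conj_I, Complex.conj_ofReal]
  ring

theorem dReG_leafY (a b : ℂ) (p : Cover) : dReG a b p (leafY a b p) = 0 := by
  simp only [dReG, leafY, map_mul, Complex.conj_I, Complex.conj_ofReal]
  ring

/-- The alternating sum of derivatives equals its conjugate, so its imaginary part vanishes. The
derivative of `h` drops out because `e₃` has neither a `θ` component nor a radial part. -/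
theorem extDeriv_leafX_leafY_e₃ {a b : ℂ} {h : ℝ → ℝ} (hh : Differentiable ℝ h) {p : Cover}
    (hp : p ∈ coverRS3) (hG : (G a b p).re ≠ 0) :
    extDeriv (fundamentalForm a b h) p ![leafX a b p, leafY a b p, e₃ p] = 0 := by
  have hG' : ((G a b p).re : ℂ) ≠ 0 := by exact_mod_cast hG
  rw [extDeriv_fundamentalForm hh hG, neg_eq_zero, ← Complex.conj_eq_iff_im]
  have e0 : ((e₃ p).1 : ℂ) = 0 := by simp [e₃]
  have eR : dReG a b p (e₃ p) = -(a.re - b.re) * (p.2.1 * p.2.2 + conj p.2.1 * conj p.2.2) := by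
    simp only [dReG, e₃, map_neg, Complex.conj_conj]
    ring
  have hI := Complex.I_sq
  simp only [dHermitian, radialPart_leafX, radialPart_leafY, radialPart_e₃, radialPart_Je₃,
    transversePart_leafX hG, transversePart_leafY hG, transversePart_e₃ a b hp,
    transversePart_Je₃ a b hp, dRadial_leafX_leafY, dRadial_leafX_e₃, dRadial_leafY_leafX,
    dRadial_leafY_e₃, dRadial_e₃_leafX, dRadial_e₃_leafY, dTransverse_leafX_leafY hG,
    dTransverse_leafY_leafX hG, eR, e0, map_zero, map_one, map_mul, map_add, map_sub, map_neg,
    map_div₀, map_pow, Complex.conj_I, Complex.conj_ofReal, Complex.conj_conj, map_ofNat, mul_zero,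
    zero_mul, add_zero, zero_add, sub_zero, zero_div]
  generalize ((G a b p).re : ℂ) = R at *
  field_simp
  ring

theorem extDeriv_leafX_leafY_Je₃ {a b : ℂ} {h : ℝ → ℝ} (hh : Differentiable ℝ h) {p : Cover}
    (hp : p ∈ coverRS3) (hG : (G a b p).re ≠ 0) :
    extDeriv (fundamentalForm a b h) p ![leafX a b p, leafY a b p, Je₃ p] = 0 := by
  have hG' : ((G a b p).re : ℂ) ≠ 0 := by exact_mod_cast hG
  rw [extDeriv_fundamentalForm hh hG, neg_eq_zero, ← Complex.conj_eq_iff_im]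
  have e0 : ((Je₃ p).1 : ℂ) = 0 := by simp [Je₃]
  have eR : dReG a b p (Je₃ p)
      = Complex.I * (a.re - b.re) * (p.2.1 * p.2.2 - conj p.2.1 * conj p.2.2) := by
    simp only [dReG, Je₃, map_neg, map_mul, Complex.conj_I, Complex.conj_conj]
    ring
  have hI := Complex.I_sq
  simp only [dHermitian, radialPart_leafX, radialPart_leafY, radialPart_e₃, radialPart_Je₃,
    transversePart_leafX hG, transversePart_leafY hG, transversePart_e₃ a b hp,
    transversePart_Je₃ a b hp, dRadial_leafX_leafY, dRadial_leafX_Je₃, dRadial_leafY_leafX,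
    dRadial_leafY_Je₃, dRadial_Je₃_leafX, dRadial_Je₃_leafY, dTransverse_leafX_leafY hG,
    dTransverse_leafY_leafX hG, eR, e0, map_zero, map_one, map_mul, map_add, map_sub, map_neg,
    map_div₀, map_pow, Complex.conj_I, Complex.conj_ofReal, Complex.conj_conj, map_ofNat, mul_zero,
    zero_mul, add_zero, zero_add, sub_zero, zero_div]
  generalize ((G a b p).re : ℂ) = R at *
  field_simp
  ring_nf
  grind

theorem extDeriv_leafY_e₃_Je₃ {a b : ℂ} {h : ℝ → ℝ} (hh : Differentiable ℝ h) {p : Cover}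
    (hp : p ∈ coverRS3) (hG : (G a b p).re ≠ 0) :
    extDeriv (fundamentalForm a b h) p ![leafY a b p, e₃ p, Je₃ p] = 0 := by
  have hG' : ((G a b p).re : ℂ) ≠ 0 := by exact_mod_cast hG
  rw [extDeriv_fundamentalForm hh hG, neg_eq_zero, ← Complex.conj_eq_iff_im]
  have hI := Complex.I_sq
  simp only [dHermitian, radialPart_leafX, radialPart_leafY, radialPart_e₃, radialPart_Je₃,
    transversePart_leafX hG, transversePart_leafY hG, transversePart_e₃ a b hp,
    transversePart_Je₃ a b hp, dReG_leafY, dRadial_e₃_leafY, dRadial_Je₃_leafY, dRadial_e₃_Je₃ a b hp,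
    dRadial_Je₃_e₃ a b hp, dTransverse_leafY_e₃ hG, dTransverse_leafY_Je₃ hG,
    dTransverse_e₃_leafY hG, dTransverse_Je₃_leafY hG, map_zero, map_one, map_mul, map_add,
    map_sub, map_neg, map_div₀, map_pow, Complex.conj_I, Complex.conj_ofReal, Complex.conj_conj,
    map_ofNat, mul_zero, zero_mul, add_zero, zero_add, sub_zero, zero_div]
  generalize ((G a b p).re : ℂ) = R at *
  field_simp

/-- The transverse terms are real in total and do not count. The two radial derivatives of `e₃` and
`Je₃` along each other are `±i`; each contributes `π h / R` to the imaginary part. -/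
theorem extDeriv_leafX_e₃_Je₃ {a b : ℂ} {h : ℝ → ℝ} (hh : Differentiable ℝ h) {p : Cover}
    (hp : p ∈ coverRS3) (hG : (G a b p).re ≠ 0) :
    extDeriv (fundamentalForm a b h) p ![leafX a b p, e₃ p, Je₃ p]
      = -(2 * Real.pi * h p.1) / (G a b p).re := by
  have hG' : ((G a b p).re : ℂ) ≠ 0 := by exact_mod_cast hG
  rw [extDeriv_fundamentalForm hh hG, neg_div, neg_inj]
  apply im_eq_of_sub_conj
  have hI := Complex.I_sq
  simp only [dHermitian, radialPart_leafX, radialPart_leafY, radialPart_e₃, radialPart_Je₃,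
    transversePart_leafX hG, transversePart_leafY hG, transversePart_e₃ a b hp,
    transversePart_Je₃ a b hp, dReG_leafX, dRadial_e₃_leafX, dRadial_Je₃_leafX, dRadial_e₃_Je₃ a b hp,
    dRadial_Je₃_e₃ a b hp, dTransverse_leafX_e₃ hG, dTransverse_leafX_Je₃ hG,
    dTransverse_e₃_leafX hG, dTransverse_Je₃_leafX hG, map_zero, map_one, map_mul, map_add,
    map_sub, map_neg, map_div₀, map_pow, Complex.conj_I, Complex.conj_ofReal, Complex.conj_conj,
    map_ofNat, mul_zero, zero_mul, add_zero, zero_add, sub_zero, zero_div, Complex.ofReal_div,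
    Complex.ofReal_mul, Complex.ofReal_ofNat]
  generalize ((G a b p).re : ℂ) = R at *
  field_simp
  ring

/-! ### The Lee form, the Lee vector and the canonical distribution -/

theorem fundamentalForm_apply {a b : ℂ} (h : ℝ → ℝ) {p : Cover} (v w : Cover) :
    fundamentalForm a b h p ![v, w] = -(hermitian a b h p v w).im := rfl

/-- An alternating `3`-form vanishes on the span of four vectors if it vanishes on the four triples
of these. -/
theorem alternating_eq_zero_of_frame {E : Type*} [AddCommGroup E] [Module ℝ E]
    (A : E [⋀^Fin 3]→ₗ[ℝ] ℝ) (f : Fin 4 → E) (h012 : A ![f 0, f 1, f 2] = 0)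
    (h013 : A ![f 0, f 1, f 3] = 0) (h023 : A ![f 0, f 2, f 3] = 0)
    (h123 : A ![f 1, f 2, f 3] = 0) (c : Fin 3 → Fin 4 → ℝ) :
    A (fun i => ∑ j, c i j • f j) = 0 := by
  have s1 : ∀ x y z, A ![y, x, z] = -A ![x, y, z] := by
    intro x y z
    rw [← A.map_swap ![x, y, z] (i := 0) (j := 1) (by decide)]
    congr 1
    ext i
    fin_cases i <;> rfl
  have s2 : ∀ x y z, A ![x, z, y] = -A ![x, y, z] := by
    intro x y z
    rw [← A.map_swap ![x, y, z] (i := 1) (j := 2) (by decide)]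
    congr 1
    ext i
    fin_cases i <;> rfl
  have key : ∀ i j k : Fin 4, i ≠ j → i ≠ k → j ≠ k → A ![f i, f j, f k] = 0 := by
    -- Increasing triples are the four hypotheses; any other triple of distinct indices is sorted by
    -- the adjacent transpositions `s1` and `s2`.
    have sorted : ∀ i j k : Fin 4, i < j → j < k → A ![f i, f j, f k] = 0 := by
      intro i j k hij hjk
      fin_cases i <;> fin_cases j <;> fin_cases k <;> 
        first
        | exact h012
        | exact h013
        | exact h023
        | exact h123
        | exact absurd hij (by decide)
        | exact absurd hjk (by decide)
    intro i j k hij hik hjk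
    rcases lt_or_gt_of_ne hij with h1 | h1 <;> rcases lt_or_gt_of_ne hik with h2 | h2 <;>
      rcases lt_or_gt_of_ne hjk with h3 | h3
    · exact sorted _ _ _ h1 h3
    · rw [s2, sorted _ _ _ h2 h3, neg_zero]
    · exact absurd (h1.trans h3) h2.not_gt
    · rw [s2, s1, sorted _ _ _ h2 h1, neg_zero, neg_zero]
    · rw [s1, sorted _ _ _ h1 h2, neg_zero]
    · exact absurd (h1.trans h2) h3.not_gt
    · rw [s1, s2, sorted _ _ _ h3 h2, neg_zero, neg_zero]
    · rw [s1, s2, s1, sorted _ _ _ h3 h1, neg_zero, neg_zero, neg_zero]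
  let L : (Fin 4 → ℝ) →ₗ[ℝ] E := Fintype.linearCombination ℝ f
  -- The four vectors need not be independent in `E`, so the form is pulled back to `ℝ⁴`, where they
  -- become the standard basis.
  have hz : A.compLinearMap L = 0 := by
    refine Module.Basis.ext_alternating (Pi.basisFun ℝ (Fin 4)) fun v hv => ?_
    have e : (fun i => L (Pi.basisFun ℝ (Fin 4) (v i))) = ![f (v 0), f (v 1), f (v 2)] := by
      ext i
      fin_cases i <;> simp [L]
    rw [AlternatingMap.compLinearMap_apply, AlternatingMap.zero_apply, e]
    exact key _ _ _ (hv.ne (by decide)) (hv.ne (by decide)) (hv.ne (by decide))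
  have := congrArg (fun B : (Fin 4 → ℝ) [⋀^Fin 3]→ₗ[ℝ] ℝ => B c) hz
  simpa [L, Fintype.linearCombination_apply] using this

section Lee

variable {a b : ℂ} {h : ℝ → ℝ} {p : Cover}

theorem fundamentalForm_leafX_leafY (hG : (G a b p).re ≠ 0) :
    fundamentalForm a b h p ![leafX a b p, leafY a b p] = Real.pi * h p.1 := by
  have hG' : ((G a b p).re : ℂ) ≠ 0 := by exact_mod_cast hG
  have e : hermitian a b h p (leafX a b p) (leafY a b p)
      = ((-(Real.pi * h p.1) : ℝ) : ℂ) * Complex.I := by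
    rw [hermitian_eq h hG, transversePart_leafX hG, radialPart_leafX, radialPart_leafY, map_mul,
      Complex.conj_I, Complex.conj_ofReal]
    push_cast
    field_simp
    ring
  rw [fundamentalForm_apply, e, Complex.im_ofReal_mul, Complex.I_im]
  ring

theorem fundamentalForm_e₃_Je₃ (hp : p ∈ coverRS3) (hG : (G a b p).re ≠ 0) :
    fundamentalForm a b h p ![e₃ p, Je₃ p] = 1 / (G a b p).re := by
  have hG' : ((G a b p).re : ℂ) ≠ 0 := by exact_mod_cast hG
  have e : hermitian a b h p (e₃ p) (Je₃ p) = ((-(1 / (G a b p).re) : ℝ) : ℂ) * Complex.I := by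
    rw [hermitian_eq h hG, transversePart_e₃ a b hp, transversePart_Je₃ a b hp, radialPart_e₃,
      Complex.conj_I]
    push_cast
    field_simp
    ring
  rw [fundamentalForm_apply, e, Complex.im_ofReal_mul, Complex.I_im]
  ring

theorem hermitian_eq_zero_of_orthogonal (hG : (G a b p).re ≠ 0) {v w : Cover}
    (hv : transversePart a b p v = 0) (hw : radialPart a b p w = 0) :
    hermitian a b h p v w = 0 ∧ hermitian a b h p w v = 0 := by
  simp [hermitian_eq h hG, hv, hw]

/-- Pairing with `leafX` sees only the real part of `radialPart`, and on tangent vectors the factors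
of `R` cancel. -/
theorem metric_leafX (hG : (G a b p).re ≠ 0) {X : Cover} (hX : X ∈ tangent p) :
    metric a b h p (leafX a b p) X = h p.1 / 2 * X.1 := by
  have hG' : ((G a b p).re : ℂ) ≠ 0 := by exact_mod_cast hG
  have e : hermitian a b h p (leafX a b p) X
      = ((Real.pi * h p.1 / (G a b p).re : ℝ) : ℂ) * conj (radialPart a b p X) := by
    rw [hermitian_eq h hG, transversePart_leafX hG, radialPart_leafX]
    push_cast
    field_simp
    ring
  have hπ := Real.pi_ne_zero
  rw [metric, e, Complex.re_ofReal_mul, Complex.conj_re, radialPart_re hX]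
  field_simp

theorem fundamentalForm_swap (v w : Cover) :
    fundamentalForm a b h p ![v, w] = -fundamentalForm a b h p ![w, v] := by
  have e := (fundamentalForm a b h p).toAlternatingMap.map_swap ![w, v]
    (i := 0) (j := 1) (by decide)
  have e2 : ![w, v] ∘ Equiv.swap (0 : Fin 2) 1 = ![v, w] := by
    ext i : 1
    fin_cases i <;> rfl
  rw [e2] at e
  exact e

/-- The wedge product of a `1`-form and a `2`-form. -/
def wedgeForm (η : Cover →L[ℝ] ℝ) (Ω : Cover [⋀^Fin 2]→L[ℝ] ℝ) : Cover [⋀^Fin 3]→L[ℝ] ℝ :=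
  ContinuousAlternatingMap.alternatizeUncurryFin (η.smulRight Ω)

theorem wedgeForm_apply (η : Cover →L[ℝ] ℝ) (X Y Z : Cover) :
    wedgeForm η (fundamentalForm a b h p) ![X, Y, Z]
      = η X * fundamentalForm a b h p ![Y, Z] + η Y * fundamentalForm a b h p ![Z, X]
          + η Z * fundamentalForm a b h p ![X, Y] := by
  rw [wedgeForm, ContinuousAlternatingMap.alternatizeUncurryFin_apply, Fin.sum_univ_three]
  have r0 : (0 : Fin 3).removeNth ![X, Y, Z] = ![Y, Z] := by
    ext i : 1; fin_cases i <;> rfl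
  have r1 : (1 : Fin 3).removeNth ![X, Y, Z] = ![X, Z] := by
    ext i : 1; fin_cases i <;> rfl
  have r2 : (2 : Fin 3).removeNth ![X, Y, Z] = ![X, Y] := by
    ext i : 1; fin_cases i <;> rfl
  rw [r0, r1, r2, fundamentalForm_swap Z X]
  simp

/-- As `Ω` pairs `leafX` with `leafY` and `e₃` with `Je₃` only, each triple isolates one value of
`η`. Since those entries of `Ω` are nonzero for positive `h`, these equations can be solved for `η`.
-/
theorem wedge_frame (hp : p ∈ coverRS3) (hG : (G a b p).re ≠ 0) (η : Cover →L[ℝ] ℝ) :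
    wedgeForm η (fundamentalForm a b h p) ![leafX a b p, leafY a b p, e₃ p]
        = η (e₃ p) * (Real.pi * h p.1) ∧
      wedgeForm η (fundamentalForm a b h p) ![leafX a b p, leafY a b p, Je₃ p]
        = η (Je₃ p) * (Real.pi * h p.1) ∧
      wedgeForm η (fundamentalForm a b h p) ![leafX a b p, e₃ p, Je₃ p]
        = η (leafX a b p) / (G a b p).re ∧
      wedgeForm η (fundamentalForm a b h p) ![leafY a b p, e₃ p, Je₃ p]
        = η (leafY a b p) / (G a b p).re := by
  have x3 := hermitian_eq_zero_of_orthogonal (h := h) hG (transversePart_leafX hG)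
    (radialPart_e₃ a b p)
  have x4 := hermitian_eq_zero_of_orthogonal (h := h) hG (transversePart_leafX hG)
    (radialPart_Je₃ a b p)
  have y3 := hermitian_eq_zero_of_orthogonal (h := h) hG (transversePart_leafY hG)
    (radialPart_e₃ a b p)
  have y4 := hermitian_eq_zero_of_orthogonal (h := h) hG (transversePart_leafY hG)
    (radialPart_Je₃ a b p)
  simp only [wedgeForm_apply, fundamentalForm_leafX_leafY hG, fundamentalForm_e₃_Je₃ hp hG]
  simp only [fundamentalForm_apply, x3, x4, y3, y4, Complex.zero_im, neg_zero, mul_zero, add_zero,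
    zero_add, mul_one_div, and_self]

theorem isLeeVector_leafX (ha : 0 < a.re) (hb : 0 < b.re) (hh : Differentiable ℝ h)
    (hp : p ∈ coverRS3) : IsLeeVector a b h p ((-2 : ℝ) • leafX a b p) := by
  have hG := (re_G_pos ha hb hp).ne'
  refine ⟨Submodule.smul_mem _ _ (leafX_mem a b p),
    -- The Lee form is `-h dθ`: on `leafX` it gives `-2 π h`, as the value `-2 π h / R` of `dΩ`
    -- requires, and it vanishes on the rest of the frame.
    (-h p.1) • ContinuousLinearMap.fst ℝ ℝ (ℂ × ℂ), fun X hX => ?_, fun X hX Y hY Z hZ => ?_⟩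
  · rw [metric, hermitian_smul_left, Complex.re_ofReal_mul]
    have := metric_leafX (h := h) hG hX
    rw [metric] at this
    rw [this]
    simp
    ring
  · rw [← wedgeForm_apply, ← sub_eq_zero]
    set η := (-h p.1) • ContinuousLinearMap.fst ℝ ℝ (ℂ × ℂ)
    obtain ⟨w1, w2, w3, w4⟩ := wedge_frame (h := h) hp hG η
    have key := alternating_eq_zero_of_frame
      (extDeriv (fundamentalForm a b h) p - wedgeForm η (fundamentalForm a b h p)).toAlternatingMap
      ![leafX a b p, leafY a b p, e₃ p, Je₃ p]
      (sub_eq_zero.2 ((extDeriv_leafX_leafY_e₃ hh hp hG).trans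
        (Eq.trans (by simp [η, e₃]) w1.symm)))
      (sub_eq_zero.2 ((extDeriv_leafX_leafY_Je₃ hh hp hG).trans
        (Eq.trans (by simp [η, Je₃]) w2.symm)))
      (sub_eq_zero.2 ((extDeriv_leafX_e₃_Je₃ hh hp hG).trans
        (Eq.trans (by simp [η, leafX]; ring) w3.symm)))
      (sub_eq_zero.2 ((extDeriv_leafY_e₃_Je₃ hh hp hG).trans
        (Eq.trans (by simp [η, leafY]) w4.symm)))
      (fun i => let v := ![X, Y, Z] i
        ![(radialPart a b p v).re / (G a b p).re, (radialPart a b p v).im / (G a b p).re,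
          (transversePart a b p v).re, (transversePart a b p v).im])
    have e : (fun i : Fin 3 => ∑ j, (fun i => let v := ![X, Y, Z] i
        ![(radialPart a b p v).re / (G a b p).re, (radialPart a b p v).im / (G a b p).re,
          (transversePart a b p v).re, (transversePart a b p v).im]) i j •
          ![leafX a b p, leafY a b p, e₃ p, Je₃ p] j) = ![X, Y, Z] := by
      ext i : 1
      have hi : ![X, Y, Z] i ∈ tangent p := by fin_cases i <;> assumption
      conv_rhs => rw [eq_frame_comb ha hb hp hi]
      simp [Fin.sum_univ_four]
    rw [e] at key
    exact key

theorem eq_of_isLeeVector (ha : 0 < a.re) (hb : 0 < b.re) (hh : Differentiable ℝ h)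
    (hpos : ∀ θ, 0 < h θ) (hp : p ∈ coverRS3) {B : Cover} (hB : IsLeeVector a b h p B) :
    B = (-2 : ℝ) • leafX a b p := by
  have hR := re_G_pos ha hb hp
  have hG := hR.ne'
  have hπ := Real.pi_pos
  have hh0 := hpos p.1
  obtain ⟨hBt, η, h1, h2⟩ := hB
  simp only [← wedgeForm_apply] at h2
  obtain ⟨w1, w2, w3, w4⟩ := wedge_frame (h := h) hp hG η
  have k1 := h2 _ (leafX_mem a b p) _ (leafY_mem a b p) _ (e₃_mem p)
  have k2 := h2 _ (leafX_mem a b p) _ (leafY_mem a b p) _ (Je₃_mem p)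
  have k3 := h2 _ (leafX_mem a b p) _ (e₃_mem p) _ (Je₃_mem p)
  have k4 := h2 _ (leafY_mem a b p) _ (e₃_mem p) _ (Je₃_mem p)
  rw [w1, extDeriv_leafX_leafY_e₃ hh hp hG] at k1
  rw [w2, extDeriv_leafX_leafY_Je₃ hh hp hG] at k2
  rw [w3, extDeriv_leafX_e₃_Je₃ hh hp hG] at k3
  rw [w4, extDeriv_leafY_e₃_Je₃ hh hp hG] at k4
  have hne : Real.pi * h p.1 ≠ 0 := by positivity
  have η3 : η (e₃ p) = 0 := (mul_eq_zero.1 k1.symm).resolve_right hne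
  have η4 : η (Je₃ p) = 0 := (mul_eq_zero.1 k2.symm).resolve_right hne
  have η1 : η (leafX a b p) = -(2 * Real.pi * h p.1) := by
    field_simp at k3
    linarith
  have η2 : η (leafY a b p) = 0 := (div_eq_zero_iff.1 k4.symm).resolve_right hG
  -- The values on the frame force `η = -h dθ` on tangent vectors.
  have hη : ∀ X ∈ tangent p, η X = -h p.1 * X.1 := by
    intro X hX
    have e := congrArg η (eq_frame_comb ha hb hp hX)
    simp only [map_add, map_smul, η1, η2, η3, η4, smul_eq_mul, mul_zero, add_zero,
      radialPart_re hX] at e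
    rw [e]
    have := hπ.ne'
    field_simp

  set C := B + (2 : ℝ) • leafX a b p with hC
  have hCt : C ∈ tangent p := Submodule.add_mem _ hBt (Submodule.smul_mem _ _ (leafX_mem a b p))
  -- `B` and `-2 leafX` have the same pairing with every tangent vector, so their difference `C` is
  -- orthogonal to itself; positivity then gives `C = 0`.
  have hCC : metric a b h p C C = 0 := by
    have e1 := h1 C hCt
    have e2 := metric_leafX (h := h) hG hCt
    rw [hη C hCt] at e1
    rw [metric] at e1 e2 ⊢
    conv_lhs => rw [hC, hermitian_add_left, hermitian_smul_left]
    rw [Complex.add_re, Complex.re_ofReal_mul, ← hC, e1, e2]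
    ring
  have hself : hermitian a b h p C C = ((Real.pi * h p.1 / (G a b p).re ^ 2
      * Complex.normSq (radialPart a b p C)
      + Complex.normSq (transversePart a b p C) / (G a b p).re : ℝ) : ℂ) := by
    rw [hermitian_eq h hG, mul_assoc, Complex.mul_conj, Complex.mul_conj]
    push_cast
    ring
  rw [metric, hself, Complex.ofReal_re] at hCC
  have n1 := Complex.normSq_nonneg (radialPart a b p C)
  have n2 := Complex.normSq_nonneg (transversePart a b p C)
  have c1 : 0 < Real.pi * h p.1 / (G a b p).re ^ 2 := by positivity
  have m1 := mul_nonneg c1.le n1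
  have m2 := div_nonneg n2 hR.le
  have z1 : radialPart a b p C = 0 := by
    have : Real.pi * h p.1 / (G a b p).re ^ 2 * Complex.normSq (radialPart a b p C) = 0 := by
      linarith
    exact Complex.normSq_eq_zero.1 ((mul_eq_zero.1 this).resolve_left c1.ne')
  have z2 : transversePart a b p C = 0 := by
    have : Complex.normSq (transversePart a b p C) / (G a b p).re = 0 := by linarith
    exact Complex.normSq_eq_zero.1 ((div_eq_zero_iff.1 this).resolve_right hG)
  have hC0 : C = 0 := by
    rw [eq_frame_comb ha hb hp hCt, z1, z2]
    simp
  rw [neg_smul]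
  exact eq_neg_of_add_eq_zero_left hC0

theorem mem_distribution_iff (ha : 0 < a.re) (hb : 0 < b.re) (hh : Differentiable ℝ h)
    (hpos : ∀ θ, 0 < h θ) (hp : p ∈ coverRS3) {v : Cover} :
    v ∈ distribution a b h p ↔ ∃ x y : ℝ, v = x • leafX a b p + y • leafY a b p := by
  have hJ : J a b p ((-2 : ℝ) • leafX a b p) = (-2 : ℝ) • leafY a b p := by
    have := J_comb_leaf ha hb hp (-2) 0
    simpa using this
  have e : distribution a b h p
      = Submodule.span ℝ {(-2 : ℝ) • leafX a b p, (-2 : ℝ) • leafY a b p} := by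
    rw [distribution]
    congr 1
    ext v
    constructor
    · rintro ⟨B, hB, rfl | rfl⟩
      · exact Or.inl (eq_of_isLeeVector ha hb hh hpos hp hB)
      · rw [eq_of_isLeeVector ha hb hh hpos hp hB, hJ]
        exact Or.inr rfl
    · rintro (rfl | rfl)
      · exact ⟨_, isLeeVector_leafX ha hb hh hp, Or.inl rfl⟩
      · exact ⟨_, isLeeVector_leafX ha hb hh hp, Or.inr hJ.symm⟩
  rw [e, Submodule.mem_span_pair]
  constructor
  · rintro ⟨x, y, rfl⟩
    exact ⟨x * -2, y * -2, by simp only [smul_smul]⟩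
  · rintro ⟨x, y, rfl⟩
    refine ⟨x / -2, y / -2, ?_⟩
    simp only [smul_smul]
    congr 2 <;> ring

end Lee

/-! ### The flow, and the leaves as its orbits -/

/-- The flow of the commuting vector fields `leafX` and `leafY`. -/
def flow (a b : ℂ) (p : Cover) (x y : ℝ) : Cover :=
  (p.1 + 2 * Real.pi * x,
    Complex.exp ((-a.im * x + a.re * y : ℝ) * Complex.I) * p.2.1,
    Complex.exp ((-b.im * x + b.re * y : ℝ) * Complex.I) * p.2.2)

theorem norm_flow_fst (a b : ℂ) (p : Cover) (x y : ℝ) :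
    ‖(flow a b p x y).2.1‖ = ‖p.2.1‖ := by
  simp only [flow, norm_mul, Complex.norm_exp_ofReal_mul_I, one_mul]

theorem norm_flow_snd (a b : ℂ) (p : Cover) (x y : ℝ) :
    ‖(flow a b p x y).2.2‖ = ‖p.2.2‖ := by
  simp only [flow, norm_mul, Complex.norm_exp_ofReal_mul_I, one_mul]

theorem flow_mem {p : Cover} (hp : p ∈ coverRS3) (a b : ℂ) (x y : ℝ) :
    flow a b p x y ∈ coverRS3 := by
  change ‖(flow a b p x y).2.1‖ ^ 2 + ‖(flow a b p x y).2.2‖ ^ 2 = 1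
  rw [norm_flow_fst, norm_flow_snd]
  exact hp

theorem flow_zero (a b : ℂ) (p : Cover) : flow a b p 0 0 = p := by
  simp [flow]

theorem contDiff_flow (a b : ℂ) (p : Cover) {n : WithTop ℕ∞} :
    ContDiff ℝ n fun z : ℝ × ℝ => flow a b p z.1 z.2 := by
  have h : ∀ c : ℂ, ContDiff ℝ n fun z : ℝ × ℝ =>
      Complex.exp ((-c.im * z.1 + c.re * z.2 : ℝ) * Complex.I) := by
    intro c
    have h1 : ContDiff ℝ n fun z : ℝ × ℝ => -c.im * z.1 + c.re * z.2 := by fun_prop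
    exact ((Complex.ofRealCLM.contDiff.comp h1).mul contDiff_const).cexp
  have ha := h a
  have hb := h b
  unfold flow
  fun_prop

theorem hasDerivAt_flow (a b : ℂ) (p : Cover) (x y x' y' t : ℝ) :
    HasDerivAt (fun t : ℝ => flow a b p (x + t * x') (y + t * y'))
      (x' • leafX a b (flow a b p (x + t * x') (y + t * y'))
        + y' • leafY a b (flow a b p (x + t * x') (y + t * y'))) t := by
  have hl : ∀ u u' : ℝ, HasDerivAt (fun t : ℝ => u + t * u') u' t := by
    intro u u'
    simpa using ((hasDerivAt_id t).mul_const u').const_add u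
  have hx := hl x x'
  have hy := hl y y'
  have he : ∀ c : ℂ, HasDerivAt (fun t : ℝ =>
      Complex.exp ((-c.im * (x + t * x') + c.re * (y + t * y') : ℝ) * Complex.I))
      (Complex.exp ((-c.im * (x + t * x') + c.re * (y + t * y') : ℝ) * Complex.I)
        * ((-c.im * x' + c.re * y' : ℝ) * Complex.I)) t := fun c =>
    (((hx.const_mul (-c.im)).add (hy.const_mul c.re)).ofReal_comp.mul_const Complex.I).cexp
  refine (((hx.const_mul (2 * Real.pi)).const_add p.1).prodMk
    (((he a).mul_const p.2.1).prodMk ((he b).mul_const p.2.2))).congr_deriv ?_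
  refine Prod.ext ?_ (Prod.ext ?_ ?_)
  · simp [leafX, leafY]
    ring
  · simp only [leafX, leafY, flow, Prod.snd_add, Prod.fst_add, Prod.smul_snd, Prod.smul_fst,
      Complex.real_smul, Complex.ofReal_add, Complex.ofReal_mul, Complex.ofReal_neg]
    ring
  · simp only [leafX, leafY, flow, Prod.snd_add, Prod.smul_snd,
      Complex.real_smul, Complex.ofReal_add, Complex.ofReal_mul, Complex.ofReal_neg]
    ring

/-- The image of the flow in `S¹ × S³`. -/
def orbitMap (a b : ℂ) (P : Ambient) (x y : ℝ) : Ambient :=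
  (P.1 + ((2 * Real.pi * x : ℝ) : Real.Angle),
    Complex.exp ((-a.im * x + a.re * y : ℝ) * Complex.I) * P.2.1,
    Complex.exp ((-b.im * x + b.re * y : ℝ) * Complex.I) * P.2.2)

theorem proj_flow (a b : ℂ) (p : Cover) (x y : ℝ) :
    proj (flow a b p x y) = orbitMap a b (proj p) x y := by
  simp [proj, flow, orbitMap]

theorem proj_surjOn {P : Ambient} (hP : P ∈ S1xS3) : ∃ p ∈ coverRS3, proj p = P := by
  obtain ⟨Θ, ξ⟩ := P
  induction Θ using Real.Angle.induction_on with
  | h θ => exact ⟨(θ, ξ), hP, rfl⟩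

theorem eq_exp_mul_of_hasDerivAt {f : ℝ → ℂ} {φ φ' : ℝ → ℝ}
    (hφ : ∀ t, HasDerivAt φ (φ' t) t) (hf : ∀ t, HasDerivAt f (φ' t * Complex.I * f t) t) (t : ℝ) :
    f t = Complex.exp ((φ t - φ 0 : ℝ) * Complex.I) * f 0 := by
  -- Integrating factor: undoing the rotation leaves a constant function.
  have hd : ∀ t, HasDerivAt (fun t => Complex.exp (-(φ t * Complex.I)) * f t) 0 t := by
    intro t
    have := (((hφ t).ofReal_comp.mul_const Complex.I).neg.cexp).mul (hf t)
    refine this.congr_deriv ?_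
    simp only [Pi.neg_apply]
    ring
  have hc := is_const_of_deriv_eq_zero (fun t => (hd t).differentiableAt)
    (fun t => (hd t).deriv) t 0
  have e : Complex.exp (φ t * Complex.I) * Complex.exp (-(φ t * Complex.I)) = 1 := by
    rw [← Complex.exp_add, add_neg_cancel, Complex.exp_zero]
  have e2 : Complex.exp ((φ t - φ 0 : ℝ) * Complex.I)
      = Complex.exp (φ t * Complex.I) * Complex.exp (-(φ 0 * Complex.I)) := by
    rw [← Complex.exp_add]
    congr 1
    push_cast
    ring
  rw [e2]
  linear_combination (-f t) * e + Complex.exp (φ t * Complex.I) * hc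

/-- The leaves are the orbits of the flow. -/
theorem leaf_eq {a b : ℂ} {h : ℝ → ℝ} (ha : 0 < a.re) (hb : 0 < b.re) (hh : Differentiable ℝ h)
    (hpos : ∀ θ, 0 < h θ) {P : Ambient} (hP : P ∈ S1xS3) :
    leaf a b h P = {Q | ∃ x y, orbitMap a b P x y = Q} := by
  ext Q
  constructor
  · rintro ⟨γ, hγ, hmem, htan, h0, h1⟩
    have hcγ : Continuous γ := hγ.continuous
    have hcγ' : Continuous (deriv γ) := hγ.continuous_deriv le_rfl
    have hd : ∀ t, HasDerivAt γ (deriv γ t) t := fun t =>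
      (hγ.differentiable one_ne_zero t).hasDerivAt
    have hd1 : ∀ t, HasDerivAt (fun t => (γ t).1) (deriv γ t).1 t := fun t =>
      (ContinuousLinearMap.fst ℝ ℝ (ℂ × ℂ)).hasFDerivAt.comp_hasDerivAt t (hd t)
    have hd2 : ∀ t, HasDerivAt (fun t => (γ t).2) (deriv γ t).2 t := fun t =>
      (ContinuousLinearMap.snd ℝ ℝ (ℂ × ℂ)).hasFDerivAt.comp_hasDerivAt t (hd t)
    have hd21 : ∀ t, HasDerivAt (fun t => (γ t).2.1) (deriv γ t).2.1 t := fun t =>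
      (ContinuousLinearMap.fst ℝ ℂ ℂ).hasFDerivAt.comp_hasDerivAt t (hd2 t)
    have hd22 : ∀ t, HasDerivAt (fun t => (γ t).2.2) (deriv γ t).2.2 t := fun t =>
      (ContinuousLinearMap.snd ℝ ℂ ℂ).hasFDerivAt.comp_hasDerivAt t (hd2 t)
    let u : ℝ → ℝ := fun t => (deriv γ t).1 / (2 * Real.pi)
    -- The coefficient of `leafY` solved from the imaginary part of the Hermitian product of `γ` and
    -- `γ'`, where `leafY` contributes `R`. The explicit formula shows that it is continuous, which
    -- membership in the span does not.
    let v : ℝ → ℝ := fun t =>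
      ((conj (γ t).2.1 * (deriv γ t).2.1 + conj (γ t).2.2 * (deriv γ t).2.2).im
        + (‖(γ t).2.1‖ ^ 2 * a.im + ‖(γ t).2.2‖ ^ 2 * b.im) * u t) / (G a b (γ t)).re
    have huv : ∀ t, deriv γ t = u t • leafX a b (γ t) + v t • leafY a b (γ t) := by
      intro t
      obtain ⟨x, y, hxy⟩ := (mem_distribution_iff ha hb hh hpos (hmem t)).1 (htan t)
      have hR := (re_G_pos ha hb (hmem t)).ne'
      have hx : u t = x := by
        have := Real.pi_ne_zero
        simp only [u, hxy]
        simp [leafX, leafY]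
      have hy : v t = y := by
        have e : conj (γ t).2.1 * (deriv γ t).2.1 + conj (γ t).2.2 * (deriv γ t).2.2
            = ((-(‖(γ t).2.1‖ ^ 2 * a.im + ‖(γ t).2.2‖ ^ 2 * b.im) * x
                + y * (G a b (γ t)).re : ℝ) : ℂ) * Complex.I := by
          have n1 := Complex.conj_mul' (γ t).2.1
          have n2 := Complex.conj_mul' (γ t).2.2
          rw [hxy]
          push_cast
          rw [ofReal_re_G, ← n1, ← n2]
          simp only [leafX, leafY, Prod.snd_add, Prod.fst_add, Prod.smul_snd, Prod.smul_fst,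
            Complex.real_smul]
          ring
        simp only [v]
        rw [e, hx, Complex.im_ofReal_mul, Complex.I_im]
        field_simp
        ring
      rw [hx, hy]
      exact hxy
    have hcv : Continuous v := by
      have c1 : Continuous fun t => (conj (γ t).2.1 * (deriv γ t).2.1
          + conj (γ t).2.2 * (deriv γ t).2.2).im := by
        have k1 : Continuous fun t => conj (γ t).2.1 :=
          Complex.continuous_conj.comp hcγ.snd.fst
        have k2 : Continuous fun t => conj (γ t).2.2 :=
          Complex.continuous_conj.comp hcγ.snd.snd
        exact Complex.continuous_im.comp
          ((k1.mul hcγ'.snd.fst).add (k2.mul hcγ'.snd.snd))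
      have c2 : Continuous u := hcγ'.fst.div_const _
      have c3 : Continuous fun t => ‖(γ t).2.1‖ := hcγ.snd.fst.norm
      have c4 : Continuous fun t => ‖(γ t).2.2‖ := hcγ.snd.snd.norm
      refine Continuous.div (by fun_prop) ((differentiable_re_G a b).continuous.comp hcγ)
        fun t => (re_G_pos ha hb (hmem t)).ne'
    -- The flow parameters of the curve. The rotation rates do not depend on the point, so the
    -- integrals of the coefficients suffice; for `x` the integral is the increment of `θ` divided
    -- by `2 π`.
    let y : ℝ → ℝ := fun t => ∫ s in (0 : ℝ)..t, v s
    let x : ℝ → ℝ := fun t => ((γ t).1 - (γ 0).1) / (2 * Real.pi)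
    have hy : ∀ t, HasDerivAt y (v t) t := fun t => hcv.integral_hasStrictDerivAt 0 t |>.hasDerivAt
    have hx : ∀ t, HasDerivAt x (u t) t := fun t => ((hd1 t).sub_const _).div_const _
    have hx0 : x 0 = 0 := by simp [x]
    have hy0 : y 0 = 0 := by simp [y]
    have hφ : ∀ c : ℂ, ∀ t, HasDerivAt (fun t => -c.im * x t + c.re * y t)
        (-c.im * u t + c.re * v t) t := fun c t =>
      ((hx t).const_mul _).add ((hy t).const_mul _)
    have r1 := eq_exp_mul_of_hasDerivAt (hφ a) (f := fun t => (γ t).2.1) (fun t => by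
      refine (hd21 t).congr_deriv ?_
      rw [huv t]
      simp only [leafX, leafY, Prod.snd_add, Prod.fst_add, Prod.smul_snd, Prod.smul_fst,
        Complex.real_smul]
      push_cast
      ring) 1
    have r2 := eq_exp_mul_of_hasDerivAt (hφ b) (f := fun t => (γ t).2.2) (fun t => by
      refine (hd22 t).congr_deriv ?_
      rw [huv t]
      simp only [leafX, leafY, Prod.snd_add, Prod.smul_snd, Complex.real_smul]
      push_cast
      ring) 1
    simp only [hx0, hy0, mul_zero, add_zero, sub_zero] at r1 r2
    refine ⟨x 1, y 1, ?_⟩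
    rw [← h0, ← h1, ← proj_flow]
    congr 1
    refine Prod.ext ?_ (Prod.ext r1.symm r2.symm)
    have := Real.pi_ne_zero
    simp only [flow, x]
    field_simp
    ring
  · rintro ⟨x, y, rfl⟩
    obtain ⟨p, hp, rfl⟩ := proj_surjOn hP
    have hd : ∀ t, HasDerivAt (fun t : ℝ => flow a b p (t * x) (t * y))
        (x • leafX a b (flow a b p (t * x) (t * y))
          + y • leafY a b (flow a b p (t * x) (t * y))) t := by
      intro t
      simpa only [zero_add] using hasDerivAt_flow a b p 0 0 x y t
    -- A point of the orbit is joined to `P` by the image of a straight segment in the parameter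
    -- plane.
    refine ⟨fun t => flow a b p (t * x) (t * y), ?_, fun t => flow_mem hp _ _ _ _, fun t => ?_,
      ?_, ?_⟩
    · have hl : ContDiff ℝ 1 fun t : ℝ => (t * x, t * y) := by fun_prop
      exact (contDiff_flow a b p).comp hl
    · rw [(hd t).deriv]
      exact (mem_distribution_iff ha hb hh hpos (flow_mem hp _ _ _ _)).2 ⟨x, y, rfl⟩
    · simp only [zero_mul, flow_zero]
    · simp only [one_mul, proj_flow]

/-! ### Angles, compactness of `S¹ × S³`, and the leaves with a vanishing coordinate -/

theorem exists_exp_mul_eq {z w : ℂ} (hzw : ‖z‖ = ‖w‖) :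
    ∃ ψ : ℝ, Complex.exp (ψ * Complex.I) * w = z := by
  rcases eq_or_ne w 0 with rfl | hw
  · refine ⟨0, ?_⟩
    rw [norm_zero, norm_eq_zero] at hzw
    simp [hzw]
  · have h1 : ‖z / w‖ = 1 := by
      rw [norm_div, hzw, div_self (norm_ne_zero_iff.2 hw)]
    refine ⟨(z / w).arg, ?_⟩
    have := Complex.norm_mul_exp_arg_mul_I (z / w)
    rw [h1, Complex.ofReal_one, one_mul] at this
    rw [this, div_mul_cancel₀ _ hw]

theorem exists_add_angle_eq (Θ Θ' : Real.Angle) :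
    ∃ x : ℝ, Θ + ((2 * Real.pi * x : ℝ) : Real.Angle) = Θ' := by
  have : ∀ δ : Real.Angle, ∃ x : ℝ, ((2 * Real.pi * x : ℝ) : Real.Angle) = δ := by
    intro δ
    induction δ using Real.Angle.induction_on with
    | h δ =>
      refine ⟨δ / (2 * Real.pi), ?_⟩
      congr 1
      have := Real.pi_ne_zero
      field_simp
  obtain ⟨x, hx⟩ := this (Θ' - Θ)
  exact ⟨x, by rw [hx, add_sub_cancel]⟩

theorem coe_two_pi_mul_eq_zero_iff (x : ℝ) :
    ((2 * Real.pi * x : ℝ) : Real.Angle) = 0 ↔ ∃ n : ℤ, x = n := by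
  rw [← Real.Angle.coe_zero, Real.Angle.angle_eq_iff_two_pi_dvd_sub]
  have := Real.two_pi_pos.ne'
  simp only [sub_zero, mul_right_inj' this]

theorem exp_mul_eq_exp_mul_iff {w : ℂ} (hw : w ≠ 0) (φ ψ : ℝ) :
    Complex.exp (φ * Complex.I) * w = Complex.exp (ψ * Complex.I) * w ↔
      ∃ n : ℤ, φ = ψ + 2 * Real.pi * n := by
  rw [mul_left_inj' hw, Complex.exp_eq_exp_iff_exists_int]
  refine exists_congr fun n => ?_
  have e : (φ * Complex.I = ψ * Complex.I + n * (2 * Real.pi * Complex.I)) ↔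
      (φ : ℂ) * Complex.I = ((ψ + 2 * Real.pi * n : ℝ) : ℂ) * Complex.I := by
    push_cast
    rw [show (ψ * Complex.I + n * (2 * Real.pi * Complex.I) : ℂ)
      = (ψ + 2 * Real.pi * n) * Complex.I by ring]
  rw [e, mul_left_inj' Complex.I_ne_zero, Complex.ofReal_inj]

theorem isClosed_S1xS3 : IsClosed S1xS3 :=
  isClosed_eq (by fun_prop) continuous_const

theorem isCompact_S1xS3 : IsCompact S1xS3 := by
  have hK : IsCompact ((Set.univ : Set Real.Angle) ×ˢ
      (Metric.closedBall (0 : ℂ) 1 ×ˢ Metric.closedBall (0 : ℂ) 1)) := by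
    have : Fact (0 < 2 * Real.pi) := ⟨Real.two_pi_pos⟩
    have : CompactSpace Real.Angle := inferInstanceAs (CompactSpace (AddCircle (2 * Real.pi)))
    exact isCompact_univ.prod ((isCompact_closedBall _ _).prod (isCompact_closedBall _ _))
  refine hK.of_isClosed_subset isClosed_S1xS3 fun P hP => ?_
  have hP' : ‖P.2.1‖ ^ 2 + ‖P.2.2‖ ^ 2 = 1 := hP
  refine ⟨Set.mem_univ _, mem_closedBall_zero_iff.2 ?_, mem_closedBall_zero_iff.2 ?_⟩
  · nlinarith [norm_nonneg P.2.1, sq_nonneg ‖P.2.2‖]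
  · nlinarith [norm_nonneg P.2.2, sq_nonneg ‖P.2.1‖]

section Leaves

variable {a b : ℂ} {h : ℝ → ℝ} (ha : 0 < a.re) (hb : 0 < b.re) (hh : Differentiable ℝ h)
  (hpos : ∀ θ, 0 < h θ) {Θ : Real.Angle} {Ξ₁ Ξ₂ : ℂ} (hΞ : (Θ, Ξ₁, Ξ₂) ∈ S1xS3)

include ha hb hh hpos hΞ

theorem leaf_subset_S1xT : leaf a b h (Θ, Ξ₁, Ξ₂) ⊆ S1xT Ξ₁ Ξ₂ := by
  rw [leaf_eq ha hb hh hpos hΞ]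
  rintro Q ⟨x, y, rfl⟩
  constructor <;>
    simp only [orbitMap, norm_mul, Complex.norm_exp_ofReal_mul_I, one_mul]

/-- Only `θ` and the phase of `ξ₁` are left to move. The parameter `x` adjusts `θ`; then `y` adjusts
the phase because `log|α|` is nonzero. -/
theorem leaf_of_snd_eq_zero (h2 : Ξ₂ = 0) :
    leaf a b h (Θ, Ξ₁, Ξ₂) = {P ∈ S1xS3 | P.2.2 = 0} := by
  subst h2
  have n1 : ‖Ξ₁‖ ^ 2 = 1 := by
    have : ‖Ξ₁‖ ^ 2 + ‖(0 : ℂ)‖ ^ 2 = 1 := hΞ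
    simpa using this
  ext ⟨Θ', ζ₁, ζ₂⟩
  constructor
  · intro hQ
    obtain ⟨m1, m2⟩ := leaf_subset_S1xT ha hb hh hpos hΞ hQ
    have m2' : ζ₂ = 0 := by simpa using m2
    refine ⟨?_, m2'⟩
    change ‖ζ₁‖ ^ 2 + ‖ζ₂‖ ^ 2 = 1
    rw [show ‖ζ₁‖ = ‖Ξ₁‖ from m1, m2', n1]
    simp
  · rintro ⟨hQ, h0⟩
    have h0' : ζ₂ = 0 := h0
    subst h0'
    have n2 : ‖ζ₁‖ ^ 2 = 1 := by
      have : ‖ζ₁‖ ^ 2 + ‖(0 : ℂ)‖ ^ 2 = 1 := hQ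
      simpa using this
    have n3 : ‖ζ₁‖ = ‖Ξ₁‖ := by
      rw [← sq_eq_sq₀ (norm_nonneg _) (norm_nonneg _), n1, n2]
    rw [leaf_eq ha hb hh hpos hΞ]
    obtain ⟨x, hx⟩ := exists_add_angle_eq Θ Θ'
    obtain ⟨ψ, hψ⟩ := exists_exp_mul_eq n3
    refine ⟨x, (ψ + a.im * x) / a.re, Prod.ext hx (Prod.ext ?_ ?_)⟩
    · simp only [orbitMap]
      rw [← hψ, show -a.im * x + a.re * ((ψ + a.im * x) / a.re) = ψ by field_simp; ring]
    · simp [orbitMap]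

theorem leaf_of_fst_eq_zero (h1 : Ξ₁ = 0) :
    leaf a b h (Θ, Ξ₁, Ξ₂) = {P ∈ S1xS3 | P.2.1 = 0} := by
  subst h1
  have n1 : ‖Ξ₂‖ ^ 2 = 1 := by
    have : ‖(0 : ℂ)‖ ^ 2 + ‖Ξ₂‖ ^ 2 = 1 := hΞ
    simpa using this
  ext ⟨Θ', ζ₁, ζ₂⟩
  constructor
  · intro hQ
    obtain ⟨m1, m2⟩ := leaf_subset_S1xT ha hb hh hpos hΞ hQ
    have m1' : ζ₁ = 0 := by simpa using m1
    refine ⟨?_, m1'⟩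
    change ‖ζ₁‖ ^ 2 + ‖ζ₂‖ ^ 2 = 1
    rw [show ‖ζ₂‖ = ‖Ξ₂‖ from m2, m1', n1]
    simp
  · rintro ⟨hQ, h0⟩
    have h0' : ζ₁ = 0 := h0
    subst h0'
    have n2 : ‖ζ₂‖ ^ 2 = 1 := by
      have : ‖(0 : ℂ)‖ ^ 2 + ‖ζ₂‖ ^ 2 = 1 := hQ
      simpa using this
    have n3 : ‖ζ₂‖ = ‖Ξ₂‖ := by
      rw [← sq_eq_sq₀ (norm_nonneg _) (norm_nonneg _), n1, n2]
    rw [leaf_eq ha hb hh hpos hΞ]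
    obtain ⟨x, hx⟩ := exists_add_angle_eq Θ Θ'
    obtain ⟨ψ, hψ⟩ := exists_exp_mul_eq n3
    refine ⟨x, (ψ + b.im * x) / b.re, Prod.ext hx (Prod.ext ?_ ?_)⟩
    · simp [orbitMap]
    · simp only [orbitMap]
      rw [← hψ, show -b.im * x + b.re * ((ψ + b.im * x) / b.re) = ψ by field_simp; ring]

end Leaves

/-! ### Return rotations, and density of the leaf when there is no relation -/

/-- The rotation angles of the second coordinate along the orbit, when the two others return. -/
def angleGroup (a b : ℂ) : AddSubgroup ℝ where
  carrier := {s | ∃ k m n : ℤ,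
    s = 2 * Real.pi * k + 2 * Real.pi * (b.re / a.re) * m + (b.re / a.re * a.im - b.im) * n}
  zero_mem' := ⟨0, 0, 0, by simp⟩
  add_mem' := by
    rintro _ _ ⟨k, m, n, rfl⟩ ⟨k', m', n', rfl⟩
    refine ⟨k + k', m + m', n + n', ?_⟩
    push_cast
    ring
  neg_mem' := by
    rintro _ ⟨k, m, n, rfl⟩
    refine ⟨-k, -m, -n, ?_⟩
    push_cast
    ring

theorem countable_angleGroup (a b : ℂ) : (angleGroup a b : Set ℝ).Countable := by
  refine (Set.countable_range fun i : ℤ × ℤ × ℤ => 2 * Real.pi * i.1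
    + 2 * Real.pi * (b.re / a.re) * i.2.1 + (b.re / a.re * a.im - b.im) * i.2.2).mono ?_
  rintro _ ⟨k, m, n, rfl⟩
  exact ⟨(k, m, n), rfl⟩

theorem zpow_eq_zpow_iff {a b : ℂ} (m n : ℤ) :
    Complex.exp a ^ m = Complex.exp b ^ n ↔
      m * a.re = n * b.re ∧ ∃ N : ℤ, m * a.im - n * b.im = 2 * Real.pi * N := by
  rw [← Complex.exp_int_mul, ← Complex.exp_int_mul, Complex.exp_eq_exp_iff_exists_int]
  constructor
  · rintro ⟨N, hN⟩
    have h1 := congrArg Complex.re hN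
    have h2 := congrArg Complex.im hN
    simp at h1 h2
    exact ⟨h1, N, by linarith⟩
  · rintro ⟨h1, N, h2⟩
    refine ⟨N, ?_⟩
    apply Complex.ext
    · simp
      exact h1
    · simp
      linarith

/-- A subgroup of `ℝ` is dense or cyclic. If it were cyclic with generator `g`, its three generators
would be `K g`, `L g`, `M g` with `K g = 2 π`. The first two give `L log|α| = K log|β|`, the third
gives `L arg α - K arg β = 2 π M`, and together `α^L = β^K`. -/
theorem dense_angleGroup {a b : ℂ} (ha : 0 < a.re)
    (hab : ¬ ∃ m n : ℤ, (m ≠ 0 ∨ n ≠ 0) ∧ Complex.exp a ^ m = Complex.exp b ^ n) :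
    Dense (angleGroup a b : Set ℝ) := by
  refine (AddSubgroup.dense_or_cyclic (angleGroup a b)).resolve_right ?_
  rintro ⟨g, hg⟩
  have hmem : ∀ s ∈ angleGroup a b, ∃ n : ℤ, n * g = s := by
    intro s hs
    rw [hg, AddSubgroup.mem_closure_singleton] at hs
    obtain ⟨n, hn⟩ := hs
    exact ⟨n, by rw [← hn, zsmul_eq_mul]⟩
  obtain ⟨K, hK⟩ := hmem (2 * Real.pi) ⟨1, 0, 0, by simp⟩
  obtain ⟨L, hL⟩ := hmem (2 * Real.pi * (b.re / a.re)) ⟨0, 1, 0, by simp⟩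
  obtain ⟨M, hM⟩ := hmem (b.re / a.re * a.im - b.im) ⟨0, 0, 1, by simp⟩
  have hπ := Real.two_pi_pos
  have hK0 : K ≠ 0 := by
    rintro rfl
    simp at hK
  have hμ : b.re / a.re * K = L := by
    have hg0 : g ≠ 0 := by
      rintro rfl
      simp at hK
    apply mul_right_cancel₀ hg0
    rw [mul_assoc, hK, hL]
    ring
  refine hab ⟨L, K, Or.inr hK0, (zpow_eq_zpow_iff L K).2 ⟨?_, M, ?_⟩⟩
  · rw [← hμ]
    field_simp
  · rw [← hμ, ← hK]
    linear_combination (-(K : ℝ)) * hM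

section Leaves

variable {a b : ℂ} {h : ℝ → ℝ} (ha : 0 < a.re) (hb : 0 < b.re) (hh : Differentiable ℝ h)
  (hpos : ∀ θ, 0 < h θ) {Θ : Real.Angle} {Ξ₁ Ξ₂ : ℂ} (hΞ : (Θ, Ξ₁, Ξ₂) ∈ S1xS3)

include ha hb hh hpos hΞ

theorem closure_leaf (hab : ¬ ∃ m n : ℤ, (m ≠ 0 ∨ n ≠ 0) ∧ Complex.exp a ^ m = Complex.exp b ^ n) :
    closure (leaf a b h (Θ, Ξ₁, Ξ₂)) = S1xT Ξ₁ Ξ₂ := by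
  have hcl : IsClosed (S1xT Ξ₁ Ξ₂) :=
    (isClosed_eq (by fun_prop) continuous_const).inter (isClosed_eq (by fun_prop) continuous_const)
  refine (hcl.closure_subset_iff.2 (leaf_subset_S1xT ha hb hh hpos hΞ)).antisymm ?_
  rintro ⟨Θ', ζ₁, ζ₂⟩ ⟨n1, n2⟩
  obtain ⟨x, hx⟩ := exists_add_angle_eq Θ Θ'
  obtain ⟨ψ₁, hψ₁⟩ := exists_exp_mul_eq (z := ζ₁) (w := Ξ₁) n1
  obtain ⟨ψ₂, hψ₂⟩ := exists_exp_mul_eq (z := ζ₂) (w := Ξ₂) n2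
  -- The rotation of `ξ₂` at the first flow parameters that reach `Θ'` and `ζ₁`. All others differ
  -- from these by the integers `n` and `m` below, which change the rotation by an element of
  -- `angleGroup`.
  set c : ℝ := -b.im * x + b.re / a.re * (ψ₁ + a.im * x) with hc
  let g : ℝ → Ambient := fun t => (Θ', ζ₁, Complex.exp ((c + t : ℝ) * Complex.I) * Ξ₂)
  have hg : Continuous g := by
    have : Continuous fun t : ℝ => ((c + t : ℝ) : ℂ) :=
      Complex.continuous_ofReal.comp (by fun_prop)
    fun_prop
  have hmaps : Set.MapsTo g (angleGroup a b) (leaf a b h (Θ, Ξ₁, Ξ₂)) := by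
    rintro _ ⟨k, m, n, rfl⟩
    rw [leaf_eq ha hb hh hpos hΞ]
    refine ⟨x + n, (ψ₁ + a.im * (x + n) + 2 * Real.pi * m) / a.re,
      Prod.ext ?_ (Prod.ext ?_ ?_)⟩
    · have : ((2 * Real.pi * n : ℝ) : Real.Angle) = 0 :=
        (coe_two_pi_mul_eq_zero_iff n).2 ⟨n, rfl⟩
      simp only [orbitMap, mul_add, Real.Angle.coe_add, this, add_zero, g, hx]
    · rcases eq_or_ne Ξ₁ 0 with h0 | h0
      · simp [orbitMap, g, ← hψ₁, h0]
      · simp only [orbitMap, g, ← hψ₁]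
        refine (exp_mul_eq_exp_mul_iff h0 _ _).2 ⟨m, ?_⟩
        field_simp
        ring
    · rcases eq_or_ne Ξ₂ 0 with h0 | h0
      · simp [orbitMap, g, h0]
      · simp only [orbitMap, g]
        refine (exp_mul_eq_exp_mul_iff h0 _ _).2 ⟨-k, ?_⟩
        rw [hc]
        push_cast
        field_simp
        ring
  -- Density lets the rotation of `ξ₂` approach the prescribed angle `ψ₂`.
  have := map_mem_closure hg (dense_angleGroup ha hab (ψ₂ - c)) hmaps
  simpa only [g, add_sub_cancel, hψ₂] using this

/-- Conversely to the inclusion used for density: the return of `θ` makes `x` an integer, the return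
of `ξ₁ ≠ 0` then fixes `y` up to the integer `m`, and the rotation of `ξ₂` is determined modulo `2
π`. -/
theorem mem_angleGroup_of_mem_leaf (h1 : Ξ₁ ≠ 0) (h2 : Ξ₂ ≠ 0) {σ : ℝ}
    (hσ : (Θ, Ξ₁, Complex.exp (σ * Complex.I) * Ξ₂) ∈ leaf a b h (Θ, Ξ₁, Ξ₂)) :
    σ ∈ angleGroup a b := by
  rw [leaf_eq ha hb hh hpos hΞ] at hσ
  obtain ⟨x, y, hxy⟩ := hσ
  obtain ⟨e0, e12⟩ := Prod.mk.inj hxy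
  obtain ⟨e1, e2⟩ := Prod.mk.inj e12
  obtain ⟨n, rfl⟩ := (coe_two_pi_mul_eq_zero_iff x).1 (add_eq_left.1 e0)
  obtain ⟨m, hm⟩ := (exp_mul_eq_exp_mul_iff h1 _ 0).1 (e1.trans (by simp))
  obtain ⟨k, hk⟩ := (exp_mul_eq_exp_mul_iff h2 _ _).1 e2
  refine ⟨-k, m, n, ?_⟩
  have hy : y = (2 * Real.pi * m + a.im * n) / a.re := by
    field_simp
    linarith
  rw [hy] at hk
  push_cast
  have : σ = -b.im * n + b.re * ((2 * Real.pi * m + a.im * n) / a.re) - 2 * Real.pi * k := by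
    linarith
  rw [this]
  field_simp
  ring

/-- A compact leaf would be closed, hence equal to `S¹ × T`. Then every real number would be a
return rotation, but those are countable. -/
theorem not_isCompact_leaf (h1 : Ξ₁ ≠ 0) (h2 : Ξ₂ ≠ 0)
    (hab : ¬ ∃ m n : ℤ, (m ≠ 0 ∨ n ≠ 0) ∧ Complex.exp a ^ m = Complex.exp b ^ n) :
    ¬ IsCompact (leaf a b h (Θ, Ξ₁, Ξ₂)) := by
  intro hc
  have hcl := closure_leaf ha hb hh hpos hΞ hab
  rw [hc.isClosed.closure_eq] at hcl
  obtain ⟨σ, hσ⟩ : ∃ σ : ℝ, σ ∉ angleGroup a b := by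
    by_contra! hall
    have hu : (angleGroup a b : Set ℝ) = Set.univ := Set.eq_univ_of_forall hall
    have := countable_angleGroup a b
    rw [hu] at this
    exact Cardinal.not_countable_real this
  refine hσ (mem_angleGroup_of_mem_leaf ha hb hh hpos hΞ h1 h2 ?_)
  rw [hcl]
  refine ⟨rfl, ?_⟩
  simp only [norm_mul, Complex.norm_exp_ofReal_mul_I, one_mul]

end Leaves

/-! ### Arithmetic of a relation between the multipliers, and the period lattice -/

theorem exists_latticeData {a b : ℂ} (hb : 0 < b.re) {m n : ℤ}
    (hmn : m ≠ 0 ∨ n ≠ 0) (h : Complex.exp a ^ m = Complex.exp b ^ n) :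
    ∃ k l p q r s : ℤ, LatticeData a b k l p q r s := by
  obtain ⟨hre, N, him⟩ := (zpow_eq_zpow_iff m n).1 h
  -- With `m = 0` the moduli would force `n log|β| = 0`, hence `n = 0`.
  have hm : m ≠ 0 := by
    rcases hmn with hm | hn
    · exact hm
    · rintro rfl
      have : (n : ℝ) * b.re = 0 := by rw [← hre]; simp
      rcases mul_eq_zero.1 this with h0 | h0
      · exact hn (by exact_mod_cast h0)
      · exact hb.ne' h0
  obtain ⟨d, k, l, hd, hkl, rfl, rfl⟩ :=
    Int.exists_gcd_one' (m := m) (n := n) (Int.gcd_pos_of_ne_zero_left n hm)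
  have hk : k ≠ 0 := by
    rintro rfl
    simp at hm
  have hd' : (d : ℝ) ≠ 0 := by exact_mod_cast hd.ne'
  have hkR : (k : ℝ) ≠ 0 := by exact_mod_cast hk
  have hcop : IsCoprime k l := Int.isCoprime_iff_gcd_eq_one.2 hkl
  obtain ⟨r, s, hrs⟩ := hcop
  push_cast at hre him
  -- With `(m, n) = d (k, l)`, the relation of arguments reads `d (k arg α - l arg β) = 2 π N`; so
  -- `p / q` is `2 N / d` in lowest terms.
  let x : ℚ := 2 * N / d
  refine ⟨k, l, x.num, x.den, r, -s, hk, by exact_mod_cast x.den_ne_zero, ⟨r, s, hrs⟩,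
    Int.isCoprime_iff_gcd_eq_one.2 x.reduced, ?_, ?_, by rw [← hrs]; ring⟩
  · have hx : (x.num : ℝ) / ((x.den : ℤ) : ℝ) = 2 * N / d := by
      have := Rat.num_div_den x
      have h2 : ((x.num : ℚ) / (x.den : ℚ) : ℚ) = 2 * N / d := this
      exact_mod_cast congrArg (Rat.cast : ℚ → ℝ) h2
    rw [hx, div_eq_div_iff Real.pi_ne_zero hd']
    linear_combination him
  · rw [div_eq_div_iff hb.ne' hkR]
    apply mul_right_cancel₀ hd'
    linear_combination hre

/-- Integers behind the parity convention: `e` is `2` for odd `p` and `1` for even `p`, so `2 q' = e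
q`, and `f` is `p'`. The divisibility clause says that `e` divides every `m` making `m p` even. -/
theorem exists_halfIfEven (p : ℤ) : ∃ e f : ℤ, e ≠ 0 ∧ e * p = 2 * f ∧
    (∀ m : ℤ, 2 ∣ m * p → e ∣ m) ∧ ∀ x : ℤ, 2 * halfIfEven p x = e * x := by
  rcases Int.even_or_odd p with hp | hp
  · obtain ⟨f, rfl⟩ := hp
    have hp' : ¬ Odd (f + f) := Int.not_odd_iff_even.2 ⟨f, rfl⟩
    refine ⟨1, f, one_ne_zero, by ring, fun m _ => one_dvd m, fun x => ?_⟩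
    rw [halfIfEven, if_neg hp']
    push_cast
    ring
  · refine ⟨2, p, two_ne_zero, rfl, fun m hm => ?_, fun x => ?_⟩
    · rcases Int.prime_two.dvd_or_dvd hm with h | h
      · exact h
      · exact absurd (even_iff_two_dvd.2 h) (Int.not_even_iff_odd.2 hp)
    · rw [halfIfEven, if_pos hp]
      push_cast
      ring

section Lattice

variable {a b : ℂ} {k l p q r s : ℤ}

/-- The periods of the orbit map are twice the lattice. -/
theorem period_iff_mem_lattice (hb : 0 < b.re) (H : LatticeData a b k l p q r s) (z : ℂ) :
    ((∃ n : ℤ, 2 * z.re = n) ∧ (∃ A : ℤ, -a.im * (2 * z.re) + a.re * (2 * z.im) = 2 * Real.pi * A) ∧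
      ∃ B : ℤ, -b.im * (2 * z.re) + b.re * (2 * z.im) = 2 * Real.pi * B) ↔
    z ∈ AddSubgroup.closure {latticeV b p q s, latticeW b k} := by
  obtain ⟨hk, hq, -, hpq, harg, hlog, hbez⟩ := H
  have hkR : (k : ℝ) ≠ 0 := by exact_mod_cast hk
  have hqR : (q : ℝ) ≠ 0 := by exact_mod_cast hq
  have hπ := Real.pi_ne_zero
  have hb' := hb.ne'
  have hre : k * a.re = l * b.re := by
    rw [div_eq_div_iff hb' hkR] at hlog
    linarith
  have him : q * (k * a.im - l * b.im) = Real.pi * p := by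
    rw [div_eq_div_iff hπ hqR] at harg
    linarith
  have hbezR : (r : ℝ) * k - s * l = 1 := by exact_mod_cast hbez
  obtain ⟨e, f, he, hef, hdiv, hhalf⟩ := exists_halfIfEven p
  have hefR : (e : ℝ) * p = 2 * f := by exact_mod_cast hef
  rw [AddSubgroup.mem_closure_pair]
  -- Doubling and multiplying by `log|β|` removes the halves and the denominators from the lattice
  -- coordinates.
  have hpair : (∃ m j : ℤ, m • latticeV b p q s + j • latticeW b k = z) ↔
      ∃ m j : ℤ, 2 * z.re = e * q * m ∧
        b.re * (2 * z.im) = m * (e * q * b.im - e * p * s * Real.pi) + 2 * k * Real.pi * j := by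
    refine exists_congr fun m => exists_congr fun j => ?_
    rw [Complex.ext_iff]
    have e1 : (m • latticeV b p q s + j • latticeW b k).re = m * halfIfEven p q := by
      simp [latticeV, latticeW]
    have e2 : (m • latticeV b p q s + j • latticeW b k).im =
        m * ((halfIfEven p q * b.im - halfIfEven p p * s * Real.pi) / b.re)
          + j * (k * Real.pi / b.re) := by
      simp [latticeV, latticeW]
    rw [e1, e2, ← hhalf q, ← hhalf p]
    refine and_congr ⟨fun h => by rw [← h]; ring, fun h => by linarith⟩ ⟨fun h => ?_, fun h => ?_⟩
    · rw [← h]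
      field_simp
    · apply mul_left_cancel₀ hb'
      field_simp
      linarith
  rw [hpair]
  constructor
  · rintro ⟨⟨n, hn⟩, ⟨A, hA⟩, B, hB⟩
    -- Take `k` times the condition on `A` minus `l` times the condition on `B`: the imaginary part
    -- of `z` cancels because `k log|α| = l log|β|`.
    have h1 : n * p = -2 * q * (k * A - l * B) := by
      have : (n : ℝ) * p = -2 * q * (k * A - l * B) := by
        apply mul_left_cancel₀ hπ
        rw [hn] at hA hB
        linear_combination (-(n : ℝ)) * him + (-(q : ℝ) * k) * hA + q * l * hB
          + 2 * q * z.im * hre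
      exact_mod_cast this
    -- Coprimality of `p` and `q` gives `q ∣ n`; the remaining factor 2 then gives divisibility by
    -- `e`, so `n = e q m`.
    have hqn : q ∣ n := by
      refine (hpq.symm.dvd_of_dvd_mul_right ?_)
      exact ⟨-2 * (k * A - l * B), by rw [h1]; ring⟩
    obtain ⟨m', rfl⟩ := hqn
    have h2 : m' * p = -2 * (k * A - l * B) := by
      apply mul_left_cancel₀ hq
      linear_combination h1
    obtain ⟨m, rfl⟩ := hdiv m' ⟨-(k * A - l * B), by rw [h2]; ring⟩
    -- The relation left is `k A - l B = -m f`. By Bézout its solutions are `A = l j - m f r`, `B =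
    -- k j - m f s`, and `j` is recovered as `r B - s A`; the converse uses the same formulas.
    refine ⟨m, r * B - s * A, ?_, ?_⟩
    · rw [hn]
      push_cast
      ring
    · have h3 : (e : ℝ) * m * p = -2 * (k * A - l * B) := by exact_mod_cast h2
      rw [hn] at hB
      push_cast at hB ⊢
      linear_combination hB + Real.pi * s * h3 - 2 * Real.pi * B * hbezR
  · rintro ⟨m, j, h1, h2⟩
    refine ⟨⟨e * q * m, by rw [h1]; push_cast; ring⟩, ⟨-(m * f * r) + l * j, ?_⟩,
      ⟨-(m * f * s) + k * j, ?_⟩⟩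
    · apply mul_left_cancel₀ hkR
      rw [h1]
      push_cast
      linear_combination 2 * z.im * hre + l * h2 - e * m * him
        + (e * m * p * Real.pi) * hbezR - (Real.pi * m * r * k) * hefR
    · rw [h1]
      push_cast
      linear_combination h2 - Real.pi * m * s * hefR

theorem halfIfEven_ne_zero (p : ℤ) {q : ℤ} (hq : q ≠ 0) : halfIfEven p q ≠ 0 := by
  have hqR : (q : ℝ) ≠ 0 := by exact_mod_cast hq
  unfold halfIfEven
  split_ifs
  · exact hqR
  · exact div_ne_zero hqR two_ne_zero

theorem linearIndependent_lattice (hb : 0 < b.re) (hk : k ≠ 0) (hq : q ≠ 0) :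
    LinearIndependent ℝ ![latticeV b p q s, latticeW b k] := by
  have hkR : (k : ℝ) ≠ 0 := by exact_mod_cast hk
  have hw : k * Real.pi / b.re ≠ 0 := div_ne_zero (mul_ne_zero hkR Real.pi_ne_zero) hb.ne'
  rw [LinearIndependent.pair_iff]
  intro x y hxy
  have h1 := congrArg Complex.re hxy
  have h2 := congrArg Complex.im hxy
  simp only [latticeV, latticeW, Complex.add_re, Complex.add_im, Complex.smul_re, Complex.smul_im,
    smul_eq_mul, mul_zero, add_zero, Complex.zero_re, Complex.zero_im] at h1 h2
  have hx : x = 0 := (mul_eq_zero.1 h1).resolve_right (halfIfEven_ne_zero p hq)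
  rw [hx, zero_mul, zero_add] at h2
  exact ⟨hx, (mul_eq_zero.1 h2).resolve_right hw⟩

end Lattice

/-! ### Compact leaves as elliptic curves -/

/-- The quotient of `ℂ` by the lattice spanned by an `ℝ`-basis is compact. -/
theorem compactSpace_quotient_lattice {v w : ℂ} (h : LinearIndependent ℝ ![v, w]) :
    CompactSpace (ℂ ⧸ AddSubgroup.closure {v, w}) := by
  let K : Set ℂ := (fun z : ℝ × ℝ => z.1 • v + z.2 • w) '' (Set.Icc 0 1 ×ˢ Set.Icc 0 1)
  have hK : IsCompact K := (isCompact_Icc.prod isCompact_Icc).image (by fun_prop)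
  have hspan : ⊤ ≤ Submodule.span ℝ (Set.range ![v, w]) :=
    (h.span_eq_top_of_card_eq_finrank (by simp)).ge
  have himg : (QuotientAddGroup.mk : ℂ → ℂ ⧸ AddSubgroup.closure {v, w}) '' K = Set.univ := by
    refine Set.eq_univ_of_forall fun Q => ?_
    obtain ⟨z, rfl⟩ := QuotientAddGroup.mk_surjective Q
    have hz : z ∈ Submodule.span ℝ ({v, w} : Set ℂ) := by
      have := hspan (Submodule.mem_top : z ∈ ⊤)
      rwa [Matrix.range_cons, Matrix.range_cons, Matrix.range_empty, Set.union_empty,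
        Set.singleton_union] at this
    obtain ⟨x, y, rfl⟩ := Submodule.mem_span_pair.1 hz
    -- Reduction to the closed fundamental parallelogram by subtracting integer parts.
    refine ⟨_, ⟨(Int.fract x, Int.fract y), ⟨⟨Int.fract_nonneg x, (Int.fract_lt_one x).le⟩,
      ⟨Int.fract_nonneg y, (Int.fract_lt_one y).le⟩⟩, rfl⟩, ?_⟩
    rw [QuotientAddGroup.eq, AddSubgroup.mem_closure_pair]
    refine ⟨⌊x⌋, ⌊y⌋, ?_⟩
    rw [← Int.self_sub_floor, ← Int.self_sub_floor, ← Int.cast_smul_eq_zsmul ℝ,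
      ← Int.cast_smul_eq_zsmul ℝ]
    module
  exact ⟨himg ▸ hK.image continuous_quot_mk⟩

section Torus

variable {a b : ℂ} {h : ℝ → ℝ} (ha : 0 < a.re) (hb : 0 < b.re) (hh : Differentiable ℝ h)
  (hpos : ∀ θ, 0 < h θ) {Θ : Real.Angle} {Ξ₁ Ξ₂ : ℂ} (hΞ : (Θ, Ξ₁, Ξ₂) ∈ S1xS3)

/-- Nonvanishing of both coordinates makes each phase well defined modulo `2 π`, so coincidences of
the orbit map depend only on the parameter difference. -/
theorem orbitMap_eq_iff (h1 : Ξ₁ ≠ 0) (h2 : Ξ₂ ≠ 0) (x y x' y' : ℝ) :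
    orbitMap a b (Θ, Ξ₁, Ξ₂) x y = orbitMap a b (Θ, Ξ₁, Ξ₂) x' y' ↔
      (∃ n : ℤ, x - x' = n) ∧ (∃ A : ℤ, -a.im * (x - x') + a.re * (y - y') = 2 * Real.pi * A) ∧
        ∃ B : ℤ, -b.im * (x - x') + b.re * (y - y') = 2 * Real.pi * B := by
  simp only [orbitMap, Prod.mk.injEq, exp_mul_eq_exp_mul_iff h1, exp_mul_eq_exp_mul_iff h2,
    add_right_inj]
  refine and_congr ?_ (and_congr (exists_congr fun n => ?_) (exists_congr fun n => ?_))
  · rw [← coe_two_pi_mul_eq_zero_iff, mul_sub, Real.Angle.coe_sub, sub_eq_zero]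
  · constructor <;> intro h <;> linarith
  · constructor <;> intro h <;> linarith

theorem continuous_orbitMap (a b : ℂ) (P : Ambient) :
    Continuous fun z : ℝ × ℝ => orbitMap a b P z.1 z.2 := by
  have h : ∀ c : ℂ, Continuous fun z : ℝ × ℝ =>
      Complex.exp ((-c.im * z.1 + c.re * z.2 : ℝ) * Complex.I) := by
    intro c
    have h1 : Continuous fun z : ℝ × ℝ => ((-c.im * z.1 + c.re * z.2 : ℝ) : ℂ) :=
      Complex.continuous_ofReal.comp (by fun_prop)
    fun_prop
  have h0 : Continuous fun z : ℝ × ℝ => ((2 * Real.pi * z.1 : ℝ) : Real.Angle) :=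
    Real.Angle.continuous_coe.comp (by fun_prop)
  exact (continuous_const.add h0).prodMk
    (((h a).mul continuous_const).prodMk ((h b).mul continuous_const))

theorem fderiv_flow (a b : ℂ) (p : Cover) (z ζ : ℂ) :
    fderiv ℝ (fun z : ℂ => flow a b p (2 * z.re) (2 * z.im)) z ζ =
      (2 * ζ.re) • leafX a b (flow a b p (2 * z.re) (2 * z.im))
        + (2 * ζ.im) • leafY a b (flow a b p (2 * z.re) (2 * z.im)) := by
  have hd : DifferentiableAt ℝ (fun z : ℂ => flow a b p (2 * z.re) (2 * z.im)) z := by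
    have hl : DifferentiableAt ℝ (fun z : ℂ => (2 * z.re, 2 * z.im)) z :=
      (Complex.reCLM.differentiableAt.const_mul 2).prodMk
        (Complex.imCLM.differentiableAt.const_mul 2)
    exact DifferentiableAt.comp z
      ((contDiff_flow a b p (n := 1)).differentiable one_ne_zero _) hl
  rw [← hd.lineDeriv_eq_fderiv]
  have := (hasDerivAt_flow a b p (2 * z.re) (2 * z.im) (2 * ζ.re) (2 * ζ.im) 0).deriv
  simp only [zero_mul, add_zero] at this
  rw [← this, lineDeriv]
  congr 1
  funext t
  simp only [Complex.add_re, Complex.add_im, Complex.smul_re, Complex.smul_im, smul_eq_mul]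
  congr 1 <;> ring

include ha hb hh hpos hΞ

/-- The orbit map has the lattice as its exact period group, so it descends to a continuous
bijection from a compact space to a Hausdorff space, a homeomorphism. Holomorphy is `J leafX =
leafY`. -/
theorem isBiholomorphicToTorus_leaf (h1 : Ξ₁ ≠ 0) (h2 : Ξ₂ ≠ 0) {k l p q r s : ℤ}
    (H : LatticeData a b k l p q r s) :
    IsBiholomorphicToTorus a b (AddSubgroup.closure {latticeV b p q s, latticeW b k})
      (leaf a b h (Θ, Ξ₁, Ξ₂)) := by
  set Λ := AddSubgroup.closure {latticeV b p q s, latticeW b k} with hΛ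
  set N := leaf a b h (Θ, Ξ₁, Ξ₂) with hN
  have hcompact : CompactSpace (ℂ ⧸ Λ) :=
    compactSpace_quotient_lattice (linearIndependent_lattice hb H.k_ne_zero H.q_ne_zero)
  -- The parameters are doubled because the true periods are twice `latticeV` and `latticeW`: their
  -- real parts are multiples of `e q = 2 q'`.
  let f : ℂ → Ambient := fun z => orbitMap a b (Θ, Ξ₁, Ξ₂) (2 * z.re) (2 * z.im)
  have hf : Continuous f := (continuous_orbitMap a b (Θ, Ξ₁, Ξ₂)).comp
    ((continuous_const.mul Complex.continuous_re).prodMk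
      (continuous_const.mul Complex.continuous_im))
  have hfN : ∀ z, f z ∈ N := by
    intro z
    rw [hN, leaf_eq ha hb hh hpos hΞ]
    exact ⟨_, _, rfl⟩
  have hiff : ∀ z z', f z = f z' ↔ z - z' ∈ Λ := by
    intro z z'
    rw [hΛ, ← period_iff_mem_lattice hb H]
    simp only [f, orbitMap_eq_iff h1 h2, Complex.sub_re, Complex.sub_im, mul_sub]
  let g : ℂ ⧸ Λ → N := Quotient.lift (fun z => (⟨f z, hfN z⟩ : N)) fun z z' hzz => by
    have hm : -z + z' ∈ Λ := QuotientAddGroup.leftRel_apply.1 hzz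
    refine Subtype.ext ((hiff z z').2 ?_)
    have := Λ.neg_mem hm
    rwa [neg_add, neg_neg, ← sub_eq_add_neg] at this
  have hgmk : ∀ z : ℂ, ((g (QuotientAddGroup.mk z) : N) : Ambient) = f z := fun z => rfl
  have hg : Continuous g := (hf.subtype_mk hfN).quotient_lift _
  have hbij : Function.Bijective g := by
    constructor
    · intro Q Q' hQ
      obtain ⟨z, rfl⟩ := QuotientAddGroup.mk_surjective Q
      obtain ⟨z', rfl⟩ := QuotientAddGroup.mk_surjective Q'
      have e : f z = f z' := congrArg Subtype.val hQ
      rw [QuotientAddGroup.eq]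
      have := Λ.neg_mem ((hiff z z').1 e)
      rwa [neg_sub, sub_eq_neg_add] at this
    · rintro ⟨Q, hQ⟩
      have hQ' := hQ
      rw [hN, leaf_eq ha hb hh hpos hΞ] at hQ'
      obtain ⟨x, y, hxy⟩ := hQ'
      refine ⟨QuotientAddGroup.mk ⟨x / 2, y / 2⟩, Subtype.ext ?_⟩
      rw [hgmk]
      simp only [f]
      rw [mul_div_cancel₀ x two_ne_zero, mul_div_cancel₀ y two_ne_zero, hxy]
  obtain ⟨P, hP, hproj⟩ := proj_surjOn hΞ
  have hP1 : P.2.1 = Ξ₁ := congrArg (fun Q : Ambient => Q.2.1) hproj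
  refine ⟨Continuous.homeoOfEquivCompactToT2 (f := Equiv.ofBijective g hbij) hg,
    fun z => flow a b P (2 * z.re) (2 * z.im), ?_, fun z => flow_mem hP _ _ _ _, fun z => ?_,
    fun z => ?_, fun z ζ => ?_⟩
  · have hl : ContDiff ℝ ∞ fun z : ℂ => (2 * z.re, 2 * z.im) :=
      (contDiff_const.mul Complex.reCLM.contDiff).prodMk
        (contDiff_const.mul Complex.imCLM.contDiff)
    exact (contDiff_flow a b P).comp hl
  · rw [proj_flow, hproj]
    rfl
  · rw [injective_iff_map_eq_zero]
    intro ζ hζ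
    rw [fderiv_flow] at hζ
    have e1 := congrArg Prod.fst hζ
    -- Only `leafX` moves `θ`; once its coefficient vanishes, `leafY` still rotates the nonzero
    -- first coordinate at speed `log|α|`.
    have hre : ζ.re = 0 := by
      simpa [leafX, leafY, Real.pi_ne_zero] using e1
    have e2 := congrArg (fun v : Cover => v.2.1) hζ
    have hne : (flow a b P (2 * z.re) (2 * z.im)).2.1 ≠ 0 := by
      rw [← norm_ne_zero_iff, norm_flow_fst, hP1, norm_ne_zero_iff]
      exact h1
    have him : ζ.im = 0 := by
      simpa [leafX, leafY, hre, ha.ne', hne] using e2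
    exact Complex.ext hre him
  · rw [fderiv_flow, fderiv_flow, J_comb_leaf ha hb (flow_mem hP _ _ _ _)]
    simp

end Torus

end HopfSurface

end

/-! ### The main theorem -/

open HopfSurface in
theorem mainTheorem1 (α β logα logβ : ℂ) (hα : 1 < ‖α‖) (hβ : 1 < ‖β‖)
    (hlogα : Complex.exp logα = α) (hlogβ : Complex.exp logβ = β)
    (h : ℝ → ℝ) (hsmooth : ContDiff ℝ ∞ h) (hper : Function.Periodic h (2 * Real.pi))
    (hpos : ∀ θ, 0 < h θ)
    (Θ : Real.Angle) (Ξ₁ Ξ₂ : ℂ) (hΞ : (Θ, Ξ₁, Ξ₂) ∈ S1xS3) :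
    (Ξ₂ = 0 →
      leaf logα logβ h (Θ, Ξ₁, Ξ₂) = {P ∈ S1xS3 | P.2.2 = 0} ∧
      IsCompact (leaf logα logβ h (Θ, Ξ₁, Ξ₂))) ∧
    (Ξ₁ = 0 →
      leaf logα logβ h (Θ, Ξ₁, Ξ₂) = {P ∈ S1xS3 | P.2.1 = 0} ∧
      IsCompact (leaf logα logβ h (Θ, Ξ₁, Ξ₂))) ∧
    (Ξ₁ * Ξ₂ ≠ 0 →
      leaf logα logβ h (Θ, Ξ₁, Ξ₂) ⊆ S1xT Ξ₁ Ξ₂ ∧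
      ((∃ m n : ℤ, (m ≠ 0 ∨ n ≠ 0) ∧ α ^ m = β ^ n) →
        IsCompact (leaf logα logβ h (Θ, Ξ₁, Ξ₂)) ∧
        (∃ k l p q r s : ℤ, LatticeData logα logβ k l p q r s) ∧
        ∀ k l p q r s : ℤ, LatticeData logα logβ k l p q r s →
          LinearIndependent ℝ ![latticeV logβ p q s, latticeW logβ k] ∧
          IsBiholomorphicToTorus logα logβ
            (AddSubgroup.closure {latticeV logβ p q s, latticeW logβ k})
            (leaf logα logβ h (Θ, Ξ₁, Ξ₂))) ∧
      ((¬ ∃ m n : ℤ, (m ≠ 0 ∨ n ≠ 0) ∧ α ^ m = β ^ n) →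
        ¬ IsCompact (leaf logα logβ h (Θ, Ξ₁, Ξ₂)) ∧
        closure (leaf logα logβ h (Θ, Ξ₁, Ξ₂)) = S1xT Ξ₁ Ξ₂)) := by
  -- Whichever logarithm is chosen, its real part is `log|α|`, positive since `|α| > 1`.
  have ha : 0 < logα.re := by
    rw [← hlogα, Complex.norm_exp] at hα
    exact Real.one_lt_exp_iff.1 hα
  have hb : 0 < logβ.re := by
    rw [← hlogβ, Complex.norm_exp] at hβ
    exact Real.one_lt_exp_iff.1 hβ
  have hh : Differentiable ℝ h := hsmooth.differentiable (by simp)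
  subst hlogα hlogβ
  refine ⟨fun h2 => ?_, fun h1 => ?_, fun h12 => ?_⟩
  · have e := leaf_of_snd_eq_zero ha hb hh hpos hΞ h2
    refine ⟨e, ?_⟩
    rw [e]
    exact isCompact_S1xS3.inter_right (isClosed_eq (by fun_prop) continuous_const)
  · have e := leaf_of_fst_eq_zero ha hb hh hpos hΞ h1
    refine ⟨e, ?_⟩
    rw [e]
    exact isCompact_S1xS3.inter_right (isClosed_eq (by fun_prop) continuous_const)
  · have h1 : Ξ₁ ≠ 0 := left_ne_zero_of_mul h12
    have h2 : Ξ₂ ≠ 0 := right_ne_zero_of_mul h12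
    refine ⟨leaf_subset_S1xT ha hb hh hpos hΞ, ?_, fun hab =>
      ⟨not_isCompact_leaf ha hb hh hpos hΞ h1 h2 hab, closure_leaf ha hb hh hpos hΞ hab⟩⟩
    rintro ⟨m, n, hmn, hab⟩
    have hdata := exists_latticeData hb hmn hab
    refine ⟨?_, hdata, fun k l p q r s H => ⟨linearIndependent_lattice hb H.k_ne_zero H.q_ne_zero,
      isBiholomorphicToTorus_leaf ha hb hh hpos hΞ h1 h2 H⟩⟩
    obtain ⟨k, l, p, q, r, s, H⟩ := hdata
    obtain ⟨φ, -⟩ := isBiholomorphicToTorus_leaf ha hb hh hpos hΞ h1 h2 H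
    have : CompactSpace (ℂ ⧸ AddSubgroup.closure {latticeV logβ p q s, latticeW logβ k}) :=
      compactSpace_quotient_lattice (linearIndependent_lattice hb H.k_ne_zero H.q_ne_zero)
    -- Compactness of the leaf is transported from the torus given by any one choice of the
    -- integers.
    exact isCompact_iff_compactSpace.2 φ.compactSpace
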